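/- For $j\in\{x,y\}$ let $\hat a_j^\dagger=\frac1{\sqrt2}\left(j-\frac{\partial}{\partial j}\right)$ and $\hat a_j=\frac1{\sqrt2}\left(j+\frac{\partial}{\partial j}\right)$, acting on functions on $\mathbb R^2$, and put $$\hat{\mathcal T}_4=\tfrac12\bigl(\hat a_x^\dagger+\hat a_x-\hat a_x^\dagger\hat a_x^\dagger\hat a_x-\hat a_x^\dagger\hat a_x\hat a_x-\hat a_x^\dagger\hat a_y^\dagger\hat a_y-\hat a_x\hat a_y^\dagger\hat a_y\bigr),$$ $$\hat{\mathcal T}_5=-\tfrac i2\bigl(\hat a_x^\dagger-\hat a_x-\hat a_x^\dagger\hat a_x^\dagger\hat a_x+\hat a_x^\dagger\hat a_x\hat a_x-\hat a_x^\dagger\hat a_y^\dagger\hat a_y+\hat a_x\hat a_y^\dagger\hat a_y\bigr),$$ and let $\hat{\mathcal T}_6,\hat{\mathcal T}_7$ be given by the expressions for $\hat{\mathcal T}_4,\hat{\mathcal T}_5$ with $x$ and $y$ interchanged. Let $$\psi_m^n(x,y)=(2^{m+n}m!\,n!\,\pi)^{-1/2}H_m(x)H_n(y)e^{-(x^2+y^2)/2}\qquad(m,n\ge0)$$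 be the Hermite–Gaussian modes, where $H_k$ are the physicists' Hermite polynomials. Regard each $\hat{\mathcal T}_k$, $4\le k\le7$, as an unbounded operator in $L^2(\mathbb R^2)$ whose domain is the space of finite linear combinations of the $\psi_m^n$. For a densely defined operator $T$ and $z\in\mathbb C\setminus\mathbb R$, the deficiency subspace of $T$ at $z$ is the orthogonal complement of the range of $T-\bar z$, that is, $\ker(T^*-z)$. We say that $T$ has deficiency indices $(p,q)$ if this subspace has dimension $p$ for every $z$ with $\operatorname{Im}z>0$ and dimension $q$ for every $z$ with $\operatorname{Im}z<0$; here $p,q\in\{0,1,2,\dots\}\cup\{\infty\}$. For a complex sequence $c=(c_m)_{m\ge0}$ let $J(c)$ be the operator in $\ell^2(\mathbb N_0)$ whose domain is the space of finite sequences and which acts by $J(c)e_m=c_me_{m+1}+\overline{c_{m-1}}\,e_{m-1}$ (without the second term if $m=0$). Put $$\beta_m^n=\tfrac12\sqrt{m+1}\,(1-m-n).$$ Then the following hold. 1. The modes $\psi_m^n$ are orthonormal, and for each fixed $n$ the isometry $e_m\mapsto\psi_m^n$ of $\ell^2(\mathbb N_0)$ onto the closed span $\mathcal H_n$ of $\{\psi_m^n:m\ge0\}$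 carries $J\bigl((\beta_m^n)_m\bigr)$ to the restriction of $\hat{\mathcal T}_4$ to $\mathcal H_n$ (whose domain is $D(\hat{\mathcal T}_4)\cap\mathcal H_n$), and $J\bigl((-i\beta_m^n)_m\bigr)$ to the restriction of $\hat{\mathcal T}_5$ to $\mathcal H_n$. In particular $\hat{\mathcal T}_4\psi_m^n=\beta_m^n\psi_{m+1}^n+\beta_{m-1}^n\psi_{m-1}^n$. In the same way $\hat{\mathcal T}_6$ and $\hat{\mathcal T}_7$ act as these two matrices in the closed span of $\{\psi_n^m:m\ge0\}$, via $e_m\mapsto\psi_n^m$. 2. For every $n$, the operators $J\bigl((\beta_m^n)_m\bigr)$ and $J\bigl((-i\beta_m^n)_m\bigr)$ are densely defined and symmetric, with deficiency indices $(1,1)$. 3. Each of $\hat{\mathcal T}_4,\hat{\mathcal T}_5,\hat{\mathcal T}_6,\hat{\mathcal T}_7$ is densely defined and symmetric, has deficiency indices $(\infty,\infty)$, and is not essentially self-adjoint. 4. One has $\hat{\mathcal T}_5=\mathcal F\hat{\mathcal T}_4\mathcal F^{-1}$, where $\mathcal F$ is the unitary Fourier transform of $L^2(\mathbb R^2)$,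 given on Schwartz functions by $(\mathcal Ff)(\xi)=\frac1{2\pi}\int_{\mathbb R^2}e^{-ix\cdot\xi}f(x)\,dx$; and $\hat{\mathcal T}_6=S\hat{\mathcal T}_4S^{-1}$, $\hat{\mathcal T}_7=S\hat{\mathcal T}_5S^{-1}$, where $(Sf)(x,y)=f(y,x)$. These are equalities of unbounded operators, domains included. -/

import Mathlib

open MeasureTheory
open scoped SchwartzMap LineDeriv ComplexConjugate ContDiff

noncomputable section

namespace CubicGenerator

/-! ### Unbounded operators on a complex Hilbert space -/

section Abstract

variable {H : Type*} [NormedAddCommGroup H] [InnerProductSpace ℂ H]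

/-- Symmetric operator: densely defined, and `⟪T x, y⟫ = ⟪x, T y⟫` for all `x`, `y` in the domain. -/
def IsSymmetricOperator (T : H →ₗ.[ℂ] H) : Prop :=
  Dense (T.domain : Set H) ∧ ∀ x y : T.domain, inner ℂ (T x) (y : H) = inner ℂ (x : H) (T y)

/-- The deficiency subspace of `T` at `z`: the orthogonal complement of the range of
`T - conj z • 1`. For a densely defined `T` this is the kernel of `T† - z • 1`. -/
def deficiencySubspace (T : H →ₗ.[ℂ] H) (z : ℂ) : Submodule ℂ H :=
  (LinearMap.range (T.toFun - conj z • T.domain.subtype))ᗮ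

/-- The dimension of the deficiency subspace at `z`, with value `⊤` if it is infinite. -/
def deficiencyDim (T : H →ₗ.[ℂ] H) (z : ℂ) : ℕ∞ :=
  Cardinal.toENat (Module.rank ℂ (deficiencySubspace T z))

/-- `T` has deficiency indices `(p, q)`: the deficiency subspaces have dimension `p` at every
point of the open upper half-plane, and `q` at every point of the open lower half-plane. -/
def HasDeficiencyIndices (T : H →ₗ.[ℂ] H) (p q : ℕ∞) : Prop :=
  (∀ z : ℂ, 0 < z.im → deficiencyDim T z = p) ∧ ∀ z : ℂ, z.im < 0 → deficiencyDim T z = q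

/-- Essential self-adjointness: the operator is closable and its closure is self-adjoint. -/
def IsEssentiallySelfAdjoint [CompleteSpace H] (T : H →ₗ.[ℂ] H) : Prop :=
  T.IsClosable ∧ IsSelfAdjoint T.closure

/-- Given an injective linear map `ι : V → H`, a subspace `D` of `V` and a linear map
`A : V → V`, the operator in `H` with domain `ι(D)` that sends `ι v` to `ι (A v)`. -/
def realize {V : Type*} [AddCommGroup V] [Module ℂ V] (ι : V →ₗ[ℂ] H)
    (hι : Function.Injective ι) (D : Submodule ℂ V) (A : V →ₗ[ℂ] V) : H →ₗ.[ℂ] H where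
  domain := D.map ι
  toFun := ι ∘ₗ A ∘ₗ D.subtype ∘ₗ (Submodule.equivMapOfInjective ι hι D).symm.toLinearMap

theorem realize_apply {V : Type*} [AddCommGroup V] [Module ℂ V] (ι : V →ₗ[ℂ] H)
    (hι : Function.Injective ι) (D : Submodule ℂ V) (A : V →ₗ[ℂ] V) (v : V) (hv : v ∈ D) :
    realize ι hι D A ⟨ι v, Submodule.mem_map_of_mem hv⟩ = ι (A v) := by
  have h : (Submodule.equivMapOfInjective ι hι D).symm
      ⟨ι v, Submodule.mem_map_of_mem hv⟩ = ⟨v, hv⟩ := by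
    rw [LinearEquiv.symm_apply_eq]
    rfl
  exact congrArg (fun w : D => ι (A w)) h

/-- `S = U ∘ T ∘ U⁻¹` as unbounded operators, domains included. -/
def IsConjugateBy (U : H ≃ₗᵢ[ℂ] H) (T S : H →ₗ.[ℂ] H) : Prop :=
  ∀ f g : H, (f, g) ∈ T.graph ↔ (U f, U g) ∈ S.graph

end Abstract

/-! ### Jacobi matrices on `ℓ²(ℕ)` -/

/-- The Hermitian Jacobi matrix with zero diagonal and subdiagonal entries `c m`
(in row `m + 1`, column `m`), acting on finite sequences:
`e_m ↦ c_m e_{m+1} + conj (c_{m-1}) e_{m-1}`, without the second term for `m = 0`. -/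
def jacobiMatrix (c : ℕ → ℂ) : (ℕ →₀ ℂ) →ₗ[ℂ] (ℕ →₀ ℂ) :=
  Finsupp.linearCombination ℂ fun m : ℕ =>
    Finsupp.single (m + 1) (c m) +
      if m = 0 then 0 else Finsupp.single (m - 1) (conj (c (m - 1)))

/-- The Hilbert space `ℓ²(ℕ)`. -/
abbrev EllTwo : Type := lp (fun _ : ℕ => ℂ) 2

/-- The embedding of the finite sequences into `ℓ²(ℕ)`. -/
def finSeq : (ℕ →₀ ℂ) →ₗ[ℂ] EllTwo :=
  Finsupp.linearCombination ℂ fun m : ℕ => (lp.single 2 m (1 : ℂ) : EllTwo)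

theorem finSeq_apply (u : ℕ →₀ ℂ) (k : ℕ) : finSeq u k = u k := by
  induction u using Finsupp.induction_linear with
  | zero => simp
  | add f g hf hg => simp [hf, hg]
  | single m a =>
    by_cases h : k = m
    · subst h
      simp [finSeq]
    · simp [finSeq, h]

theorem finSeq_injective : Function.Injective finSeq := by
  intro u v h
  ext k
  rw [← finSeq_apply u k, ← finSeq_apply v k, h]

/-- The operator in `ℓ²(ℕ)` defined by the Jacobi matrix on the domain of finite sequences. -/
def jacobiOperator (c : ℕ → ℂ) : EllTwo →ₗ.[ℂ] EllTwo :=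
  realize finSeq finSeq_injective ⊤ (jacobiMatrix c)

/-! ### Creation and annihilation operators, and the cubic generators -/

/-- The Euclidean plane; coordinate `0` is `x`, coordinate `1` is `y`. -/
abbrev Plane : Type := EuclideanSpace ℝ (Fin 2)

/-- The Hilbert space `L²(ℝ²)` of complex-valued functions. -/
abbrev LTwo : Type := Lp ℂ 2 (volume : Measure Plane)

/-- Multiplication by the `i`-th coordinate. -/
def position (i : Fin 2) : Module.End ℂ 𝓢(Plane, ℂ) :=
  (SchwartzMap.smulLeftCLM ℂ fun p : Plane => ((p i : ℝ) : ℂ)).toLinearMap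

/-- Differentiation in the `i`-th coordinate. -/
def partialDeriv (i : Fin 2) : Module.End ℂ 𝓢(Plane, ℂ) :=
  (LineDeriv.lineDerivOpCLM ℂ 𝓢(Plane, ℂ) (EuclideanSpace.single i (1 : ℝ))).toLinearMap

theorem coord_hasTemperateGrowth (i : Fin 2) :
    (fun p : Plane => p i).HasTemperateGrowth :=
  (EuclideanSpace.proj (𝕜 := ℝ) i).hasTemperateGrowth

theorem position_apply (i : Fin 2) (f : 𝓢(Plane, ℂ)) (p : Plane) :
    position i f p = ((p i : ℝ) : ℂ) * f p := by
  have h : (fun p : Plane => ((p i : ℝ) : ℂ)).HasTemperateGrowth :=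
    Function.HasTemperateGrowth.comp Function.Complex.hasTemperateGrowth_ofReal (coord_hasTemperateGrowth i)
  exact SchwartzMap.smulLeftCLM_apply_apply h f p

theorem partialDeriv_apply (i : Fin 2) (f : 𝓢(Plane, ℂ)) (p : Plane) :
    partialDeriv i f p = lineDeriv ℝ f p (EuclideanSpace.single i (1 : ℝ)) :=
  SchwartzMap.lineDerivOp_apply _ f p

/-- Creation operator `(x_i - ∂_i) / √2`. -/
def cr (i : Fin 2) : Module.End ℂ 𝓢(Plane, ℂ) :=
  ((1 / √2 : ℝ) : ℂ) • (position i - partialDeriv i)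

/-- Annihilation operator `(x_i + ∂_i) / √2`. -/
def an (i : Fin 2) : Module.End ℂ 𝓢(Plane, ℂ) :=
  ((1 / √2 : ℝ) : ℂ) • (position i + partialDeriv i)

/-- The differential expression of the fourth generator. -/
def expr4 : Module.End ℂ 𝓢(Plane, ℂ) :=
  (1 / 2 : ℂ) • (cr 0 + an 0 - cr 0 * cr 0 * an 0 - cr 0 * an 0 * an 0
    - cr 0 * cr 1 * an 1 - an 0 * cr 1 * an 1)

/-- The differential expression of the fifth generator. -/
def expr5 : Module.End ℂ 𝓢(Plane, ℂ) :=
  (-(Complex.I / 2)) • (cr 0 - an 0 - cr 0 * cr 0 * an 0 + cr 0 * an 0 * an 0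
    - cr 0 * cr 1 * an 1 + an 0 * cr 1 * an 1)

/-- The differential expression of the sixth generator. -/
def expr6 : Module.End ℂ 𝓢(Plane, ℂ) :=
  (1 / 2 : ℂ) • (cr 1 + an 1 - cr 1 * cr 1 * an 1 - cr 1 * an 1 * an 1
    - cr 1 * cr 0 * an 0 - an 1 * cr 0 * an 0)

/-- The differential expression of the seventh generator. -/
def expr7 : Module.End ℂ 𝓢(Plane, ℂ) :=
  (-(Complex.I / 2)) • (cr 1 - an 1 - cr 1 * cr 1 * an 1 + cr 1 * an 1 * an 1
    - cr 1 * cr 0 * an 0 + an 1 * cr 0 * an 0)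

/-! ### Hermite-Gaussian modes -/

theorem one_add_pow_mul_exp_le (N : ℕ) (r : ℝ) (hr : 0 ≤ r) :
    (1 + r) ^ N * Real.exp (-(r ^ 2 / 2)) ≤ N.factorial * Real.exp (3 / 2) := by
  have h1 : (1 + r) ^ N ≤ N.factorial * Real.exp (1 + r) := by
    have h := Real.pow_div_factorial_le_exp (1 + r) (by linarith) N
    rwa [div_le_iff₀ (by positivity), mul_comm] at h
  calc (1 + r) ^ N * Real.exp (-(r ^ 2 / 2))
      ≤ (N.factorial * Real.exp (1 + r)) * Real.exp (-(r ^ 2 / 2)) := by gcongr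
    _ = N.factorial * Real.exp (1 + r + -(r ^ 2 / 2)) := by rw [mul_assoc, ← Real.exp_add]
    _ ≤ N.factorial * Real.exp (3 / 2) := by
        gcongr
        nlinarith [sq_nonneg (r - 1)]

/-- The Gaussian `exp (-(x² + y²) / 2)` as a Schwartz function. -/
def gaussian : 𝓢(Plane, ℂ) where
  toFun p := ((Real.exp (-(‖p‖ ^ 2 / 2)) : ℝ) : ℂ)
  smooth' := by
    have h : ContDiff ℝ ∞ fun p : Plane => Real.exp (-(‖p‖ ^ 2 / 2)) :=
      (((contDiff_norm_sq ℝ).div_const 2).neg).exp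
    exact Complex.ofRealCLM.contDiff.comp h
  decay' := by
    intro k n
    have hq : (fun p : Plane => -(‖p‖ ^ 2 / 2)).HasTemperateGrowth := by
      have h := (Function.HasTemperateGrowth.mul
        (Function.HasTemperateGrowth.const (E := Plane) (-(1 / 2 : ℝ)))
        (Function.hasTemperateGrowth_norm_sq (H := Plane)))
      have he : (fun p : Plane => -(‖p‖ ^ 2 / 2))
          = (fun _ : Plane => -(1 / 2 : ℝ)) * fun p : Plane => ‖p‖ ^ 2 := by
        funext p
        simp only [Pi.mul_apply]
        ring
      rw [he]
      exact h
    obtain ⟨l, C, hC, hb⟩ := hq.norm_iteratedFDeriv_le_uniform n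
    refine ⟨n.factorial * (1 + C) ^ n *
      ((k + l * n).factorial * Real.exp (3 / 2)), fun p => ?_⟩
    have h1 : ‖iteratedFDeriv ℝ n (fun p : Plane => Real.exp (-(‖p‖ ^ 2 / 2))) p‖
        ≤ n.factorial * Real.exp (-(‖p‖ ^ 2 / 2)) * ((1 + C) * (1 + ‖p‖) ^ l) ^ n := by
      refine norm_iteratedFDeriv_comp_le (g := Real.exp) (N := ∞) Real.contDiff_exp
        hq.1 (by exact_mod_cast le_top) p ?_ ?_
      · intro i _
        rw [norm_iteratedFDeriv_eq_norm_iteratedDeriv, iteratedDeriv_eq_iterate,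
          Real.iter_deriv_exp, Real.norm_eq_abs, abs_of_pos (Real.exp_pos _)]
      · intro i hi1 hi
        have hone : 1 ≤ (1 + C) * (1 + ‖p‖) ^ l :=
          one_le_mul_of_one_le_of_one_le (by linarith)
            (one_le_pow₀ (by linarith [norm_nonneg p]))
        calc _ ≤ C * (1 + ‖p‖) ^ l := hb i hi p
          _ ≤ (1 + C) * (1 + ‖p‖) ^ l := by gcongr; linarith
          _ ≤ ((1 + C) * (1 + ‖p‖) ^ l) ^ i := le_self_pow₀ hone (by omega)
    have h2 : ‖iteratedFDeriv ℝ n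
        (fun p : Plane => ((Real.exp (-(‖p‖ ^ 2 / 2)) : ℝ) : ℂ)) p‖
        = ‖iteratedFDeriv ℝ n (fun p : Plane => Real.exp (-(‖p‖ ^ 2 / 2))) p‖ :=
      Complex.ofRealLI.norm_iteratedFDeriv_comp_left
        (f := fun p : Plane => Real.exp (-(‖p‖ ^ 2 / 2)))
        (((contDiff_norm_sq ℝ).div_const 2).neg.exp.contDiffAt) (n := ∞)
        (by exact_mod_cast le_top)
    rw [h2]
    have h3 := one_add_pow_mul_exp_le (k + l * n) ‖p‖ (norm_nonneg p)
    calc ‖p‖ ^ k * _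
        ≤ (1 + ‖p‖) ^ k *
          (n.factorial * Real.exp (-(‖p‖ ^ 2 / 2)) * ((1 + C) * (1 + ‖p‖) ^ l) ^ n) := by
          gcongr
          linarith
      _ = n.factorial * (1 + C) ^ n *
          ((1 + ‖p‖) ^ (k + l * n) * Real.exp (-(‖p‖ ^ 2 / 2))) := by
          rw [mul_pow, pow_add, pow_mul]
          ring
      _ ≤ _ := by gcongr

/-- The polynomial factor of the mode of order `(m, n)`. Mathlib's `Polynomial.hermite` is the
probabilists' polynomial, related to the physicists' one by `H_m(t) = 2^{m/2} He_m(√2 t)`. -/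
def modePolynomial (m n : ℕ) (p : Plane) : ℂ :=
  ((Polynomial.aeval (√2 * p 0) (Polynomial.hermite m) *
    Polynomial.aeval (√2 * p 1) (Polynomial.hermite n) : ℝ) : ℂ)

theorem aeval_hasTemperateGrowth (P : Polynomial ℤ) (i : Fin 2) :
    (fun p : Plane => Polynomial.aeval (√2 * p i) P).HasTemperateGrowth := by
  have hl : (fun p : Plane => √2 * p i).HasTemperateGrowth :=
    Function.HasTemperateGrowth.mul (Function.HasTemperateGrowth.const _)
      (coord_hasTemperateGrowth i)
  have he : (fun p : Plane => Polynomial.aeval (√2 * p i) P)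
      = fun p : Plane => ∑ k ∈ Finset.range (P.natDegree + 1),
          (P.coeff k : ℝ) * (√2 * p i) ^ k := by
    funext p
    rw [Polynomial.aeval_eq_sum_range]
    simp
  rw [he]
  exact Function.HasTemperateGrowth.sum fun k _ =>
    Function.HasTemperateGrowth.mul (Function.HasTemperateGrowth.const _) (hl.pow k)

theorem modePolynomial_hasTemperateGrowth (m n : ℕ) :
    (modePolynomial m n).HasTemperateGrowth :=
  Function.HasTemperateGrowth.comp Function.Complex.hasTemperateGrowth_ofReal
    (Function.HasTemperateGrowth.mul (aeval_hasTemperateGrowth _ 0)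
      (aeval_hasTemperateGrowth _ 1))

/-- The normalized Hermite-Gaussian mode of order `m` in `x` and `n` in `y`. -/
def mode (m n : ℕ) : 𝓢(Plane, ℂ) :=
  ((1 / √(Real.pi * m.factorial * n.factorial) : ℝ) : ℂ) •
    SchwartzMap.smulLeftCLM ℂ (modePolynomial m n) gaussian

theorem mode_apply (m n : ℕ) (p : Plane) :
    mode m n p = ((1 / √(Real.pi * m.factorial * n.factorial) *
      Polynomial.aeval (√2 * p 0) (Polynomial.hermite m) *
      Polynomial.aeval (√2 * p 1) (Polynomial.hermite n) *
      Real.exp (-(p 0 ^ 2 + p 1 ^ 2) / 2) : ℝ) : ℂ) := by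
  have hg : gaussian p = ((Real.exp (-(‖p‖ ^ 2 / 2)) : ℝ) : ℂ) := rfl
  have hn : -(‖p‖ ^ 2 / 2) = -(p 0 ^ 2 + p 1 ^ 2) / 2 := by
    rw [EuclideanSpace.norm_sq_eq]
    simp [Fin.sum_univ_two]
    ring
  rw [mode, smul_apply,
    SchwartzMap.smulLeftCLM_apply_apply (modePolynomial_hasTemperateGrowth m n), hg, hn,
    modePolynomial]
  simp only [smul_eq_mul]
  push_cast
  ring

/-- The finite linear combinations of Hermite-Gaussian modes. -/
def modeSpan : Submodule ℂ 𝓢(Plane, ℂ) :=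
  Submodule.span ℂ (Set.range fun k : ℕ × ℕ => mode k.1 k.2)

/-- The embedding of the Schwartz space into `L²(ℝ²)`. -/
def toLTwo : 𝓢(Plane, ℂ) →ₗ[ℂ] LTwo :=
  (SchwartzMap.toLpCLM ℂ ℂ 2 (volume : Measure Plane)).toLinearMap

theorem toLTwo_injective : Function.Injective toLTwo :=
  SchwartzMap.injective_toLp 2 (volume : Measure Plane)

/-- The operator in `L²(ℝ²)` whose domain is the space of finite linear combinations of
Hermite-Gaussian modes, on which it acts by the given differential expression. -/
def onModes (A : Module.End ℂ 𝓢(Plane, ℂ)) : LTwo →ₗ.[ℂ] LTwo :=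
  realize toLTwo toLTwo_injective modeSpan A

/-- The fourth generator as an unbounded operator in `L²(ℝ²)`. -/
def T4 : LTwo →ₗ.[ℂ] LTwo := onModes expr4

/-- The fifth generator as an unbounded operator in `L²(ℝ²)`. -/
def T5 : LTwo →ₗ.[ℂ] LTwo := onModes expr5

/-- The sixth generator as an unbounded operator in `L²(ℝ²)`. -/
def T6 : LTwo →ₗ.[ℂ] LTwo := onModes expr6

/-- The seventh generator as an unbounded operator in `L²(ℝ²)`. -/
def T7 : LTwo →ₗ.[ℂ] LTwo := onModes expr7

/-! ### Sectors -/

/-- In the closed span of the orthonormal sequence `φ`, the operator `T` acts as the Jacobi matrix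
with subdiagonal `c`: the isometry `V` of `ℓ²(ℕ)` onto that closed span with `V e_m = φ m` carries
the Jacobi operator to the restriction of `T` to that closed span. That is, `V u` lies in the domain of `T` if and only if `u` is a finite sequence, and
`T (V u) = V (J u)` then. -/
def ActsAsJacobi (T : LTwo →ₗ.[ℂ] LTwo) (φ : ℕ → LTwo) (c : ℕ → ℂ) : Prop :=
  ∃ V : EllTwo →ₗᵢ[ℂ] LTwo, (∀ m : ℕ, V (lp.single 2 m (1 : ℂ)) = φ m) ∧
    (∀ u : EllTwo, V u ∈ T.domain ↔ u ∈ (jacobiOperator c).domain) ∧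
    ∀ u w : EllTwo, (u, w) ∈ (jacobiOperator c).graph → (V u, V w) ∈ T.graph

/-! ### Matrix entries, Fourier transform, interchange of the variables -/

/-- `β_m^n = √(m + 1) (1 - m - n) / 2`. -/
def β (n m : ℕ) : ℝ := 1 / 2 * √((m : ℝ) + 1) * (1 - (m : ℝ) - (n : ℝ))

/-- The unitary Fourier transform of `L²(ℝ²)`: the unitary operator that is given on Schwartz
functions by `(𝓕 f)(ξ) = (2π)⁻¹ ∫ exp (-i x·ξ) f(x) dx`. -/
def IsFourierTransform (U : LTwo ≃ₗᵢ[ℂ] LTwo) : Prop :=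
  ∀ f : 𝓢(Plane, ℂ), (U (toLTwo f) : Plane → ℂ) =ᵐ[volume] fun ξ =>
    ((1 / (2 * Real.pi) : ℝ) : ℂ) *
      ∫ x : Plane, Complex.exp (-(Complex.I * ((inner ℝ x ξ : ℝ) : ℂ))) * f x

/-- The interchange of the variables, `(S f)(x, y) = f(y, x)`. -/
def IsInterchange (U : LTwo ≃ₗᵢ[ℂ] LTwo) : Prop :=
  ∀ f : LTwo, (U f : Plane → ℂ) =ᵐ[volume] fun p => (f : Plane → ℂ) !₂[p 1, p 0]

end CubicGenerator

end

open CubicGenerator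

/-! Every monomial in a generator shifts the order in one variable by exactly one and preserves the
order in the other. Each generator is therefore an orthogonal sum of Jacobi matrices, indexed by the
preserved order `n`, and membership in a deficiency subspace is a three-term recurrence for the
coordinates in each sector (`HasJacobiSectors.mem_deficiencySubspace_iff`).

The entries `β n m` have modulus of order `m ^ (3/2)`: their inverses are summable, and from the
tail's starting index on the moduli are log-concave. By Berezanskii's criterion
(`summable_norm_sq_of_recurrence`) every solution of the recurrence is then square-summable, for
every `z`. A Jacobi matrix with nonvanishing entries has a one-dimensional space of solutions, so
its deficiency indices are `(1, 1)`. For `n = 0` and `n = 1` one entry vanishes, at `m + n = 1`. It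
splits off a finite Hermitian block, which has no non-real eigenvalue, and the infinite tail alone
produces the deficiency vector. Only the moduli of the entries matter, so the factor `-i` is
harmless.

Deficiency vectors from different sectors are orthogonal. Infinitely many sectors thus give infinite
deficiency indices, and a single nonzero deficiency vector already excludes essential
self-adjointness.

That the modes are orthonormal follows from the ladder relations and the mutual adjointness of
creation and annihilation. That they are total follows from injectivity of the Fourier transform: if
`f` is orthogonal to all modes, then all moments of the Gaussian times `f` vanish, hence so does its
Fourier transform. Finally, the Fourier transform multiplies creation by `-i` and annihilation by
`i` and is diagonal on the modes, which turns the fourth generator into the fifth with the domain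
preserved; the interchange of variables permutes the modes. -/

noncomputable section

namespace CubicGenerator

/-! ### Operators that split into Jacobi matrices: symmetry and deficiency subspaces -/

section JacobiSectors

variable {H : Type*} [NormedAddCommGroup H] [InnerProductSpace ℂ H] {κ : Type*}

/-- The image of the `m`-th vector of the sequence `φ` under the Jacobi matrix with
subdiagonal `c`. -/
def jacobiImage {M : Type*} [AddCommGroup M] [Module ℂ M] (c : ℕ → ℂ) (φ : ℕ → M) : ℕ → M
  | 0 => c 0 • φ 1
  | m + 1 => c (m + 1) • φ (m + 2) + conj (c m) • φ m

theorem map_jacobiImage {M N : Type*} [AddCommGroup M] [Module ℂ M] [AddCommGroup N] [Module ℂ N]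
    (f : M →ₗ[ℂ] N) (c : ℕ → ℂ) (φ : ℕ → M) (m : ℕ) :
    f (jacobiImage c φ m) = jacobiImage c (fun k => f (φ k)) m := by
  cases m <;> simp [jacobiImage]

/-- The domain of `T` is the span of a total orthonormal family `φ k m`, and for each `k` the
operator `T` acts on the vectors `φ k m` by the Jacobi matrix with subdiagonal `c k`. -/
structure HasJacobiSectors (T : H →ₗ.[ℂ] H) (φ : κ → ℕ → H) (c : κ → ℕ → ℂ) : Prop where
  orthonormal : Orthonormal ℂ fun k : κ × ℕ => φ k.1 k.2
  dense : Dense (T.domain : Set H)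
  domain_eq : T.domain = Submodule.span ℂ (Set.range fun k : κ × ℕ => φ k.1 k.2)
  graph_mem : ∀ k m, (φ k m, jacobiImage (c k) (φ k) m) ∈ T.graph

theorem inner_jacobiImage_zero (c : ℕ → ℂ) (φ : ℕ → H) (f : H) :
    inner ℂ (jacobiImage c φ 0) f = conj (c 0) * inner ℂ (φ 1) f := by
  rw [jacobiImage, inner_smul_left]

theorem inner_jacobiImage_succ (c : ℕ → ℂ) (φ : ℕ → H) (f : H) (m : ℕ) :
    inner ℂ (jacobiImage c φ (m + 1)) f =
      conj (c (m + 1)) * inner ℂ (φ (m + 2)) f + c m * inner ℂ (φ m) f := by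
  rw [jacobiImage, inner_add_left, inner_smul_left, inner_smul_left, Complex.conj_conj]

theorem inner_jacobiImage_comm {φ : κ → ℕ → H}
    (hφ : Orthonormal ℂ fun k : κ × ℕ => φ k.1 k.2) (c : κ → ℕ → ℂ) (k l : κ) (m n : ℕ) :
    inner ℂ (jacobiImage (c k) (φ k) m) (φ l n) =
      inner ℂ (φ k m) (jacobiImage (c l) (φ l) n) := by
  classical
  have h : ∀ k l m n, inner ℂ (φ k m) (φ l n) = if k = l ∧ m = n then (1 : ℂ) else 0 := by
    intro k l m n
    simpa [Prod.ext_iff] using (orthonormal_iff_ite.mp hφ) (k, m) (l, n)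
  by_cases hkl : k = l
  · subst hkl
    rcases m with _ | m <;> rcases n with _ | n <;>
      simp only [jacobiImage, inner_add_left, inner_add_right, inner_smul_left, inner_smul_right,
        h, true_and, Complex.conj_conj] <;>
      split_ifs <;> first | omega | simp_all
  · rcases m with _ | m <;> rcases n with _ | n <;> simp [jacobiImage, h, hkl]

/-- In graph form the condition is closed under linear combinations of `(x, y)`, so it can be tested
on basis vectors, and it also passes to limits. -/
theorem mem_deficiencySubspace_iff (T : H →ₗ.[ℂ] H) (z : ℂ) (f : H) :
    f ∈ deficiencySubspace T z ↔
      ∀ x y : H, (x, y) ∈ T.graph → inner ℂ y f = z * inner ℂ x f := by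
  simp only [deficiencySubspace, Submodule.mem_orthogonal, LinearMap.mem_range,
    forall_exists_index, forall_apply_eq_imp_iff]
  constructor
  · intro h x y hxy
    obtain ⟨u, rfl, rfl⟩ := (LinearPMap.mem_graph_iff T).mp hxy
    have := h u
    simpa [inner_sub_left, inner_smul_left, sub_eq_zero] using this
  · intro h u
    have := h u (T u) (T.mem_graph u)
    simpa [inner_sub_left, inner_smul_left, sub_eq_zero] using this

/-- By continuity the deficiency relation extends to the graph of the closure, so `(f, z • f)` lies
in the adjoint of that graph, which is the graph itself. Inserting this pair into the relation gives
`(conj z - z) * ‖f‖ ^ 2 = 0`. -/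
theorem eq_zero_of_mem_deficiencySubspace [CompleteSpace H] {T : H →ₗ.[ℂ] H}
    (hT : IsEssentiallySelfAdjoint T) {z : ℂ} (hz : z.im ≠ 0) {f : H}
    (hf : f ∈ deficiencySubspace T z) : f = 0 := by
  obtain ⟨hc, hs⟩ := hT
  rw [mem_deficiencySubspace_iff] at hf
  have hadj : T.closure.graph = T.closure.graph.adjoint := by
    conv_lhs => rw [← (LinearPMap.isSelfAdjoint_def.mp hs)]
    exact LinearPMap.adjoint_graph_eq_graph_adjoint hs.dense_domain
  have hcl : ∀ p : H × H, p ∈ T.closure.graph →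
      inner ℂ p.2 f - inner ℂ p.1 (z • f) = (0 : ℂ) := by
    intro p hp
    rw [← hc.graph_closure_eq_closure_graph, ← SetLike.mem_coe,
      Submodule.topologicalClosure_coe] at hp
    refine closure_minimal (s := (T.graph : Set (H × H)))
      (t := {p | inner ℂ p.2 f - inner ℂ p.1 (z • f) = (0 : ℂ)}) ?_ ?_ hp
    · rintro ⟨x, y⟩ hxy
      simp [hf x y hxy]
    · exact isClosed_eq (by fun_prop) continuous_const
  have hmem : (f, z • f) ∈ T.closure.graph := by
    rw [hadj, Submodule.mem_adjoint_iff]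
    exact fun a b hab => hcl (a, b) hab
  have h := hcl _ hmem
  simp only [inner_smul_left, inner_smul_right, ← sub_mul, mul_eq_zero, inner_self_eq_zero] at h
  refine h.resolve_left fun h0 => hz ?_
  have := congrArg Complex.im h0
  simp at this
  linarith

namespace HasJacobiSectors

variable {T : H →ₗ.[ℂ] H} {φ : κ → ℕ → H} {c : κ → ℕ → ℂ}

/-- The domain is spanned by the basis vectors and a graph is single-valued, so any property of
pairs that respects linear combinations needs checking only on the basis. -/
theorem graph_induction (h : HasJacobiSectors T φ c) (P : H × H → Prop)
    (basis : ∀ k m, P (φ k m, jacobiImage (c k) (φ k) m)) (zero : P 0)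
    (add : ∀ p q, P p → P q → P (p + q)) (smul : ∀ (a : ℂ) p, P p → P (a • p))
    {x y : H} (hxy : (x, y) ∈ T.graph) : P (x, y) := by
  have key : ∀ x ∈ Submodule.span ℂ (Set.range fun k : κ × ℕ => φ k.1 k.2),
      ∃ y, (x, y) ∈ T.graph ∧ P (x, y) := by
    intro x hx
    induction hx using Submodule.span_induction with
    | mem x hx =>
      obtain ⟨k, rfl⟩ := hx
      exact ⟨_, h.graph_mem k.1 k.2, basis k.1 k.2⟩
    | zero => exact ⟨0, T.graph.zero_mem, zero⟩
    | add x x' _ _ hx hx' =>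
      obtain ⟨y, hy, hP⟩ := hx
      obtain ⟨y', hy', hP'⟩ := hx'
      exact ⟨y + y', T.graph.add_mem hy hy', add _ _ hP hP'⟩
    | smul a x _ hx =>
      obtain ⟨y, hy, hP⟩ := hx
      exact ⟨a • y, T.graph.smul_mem a hy, smul a _ hP⟩
  have hx : x ∈ T.domain := LinearPMap.mem_domain_of_mem_graph hxy
  rw [h.domain_eq] at hx
  obtain ⟨y', hy', hP⟩ := key x hx
  rwa [T.mem_graph_snd_inj hxy hy' rfl]

theorem mem_deficiencySubspace_iff (h : HasJacobiSectors T φ c) (z : ℂ) (f : H) :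
    f ∈ deficiencySubspace T z ↔
      ∀ k m, inner ℂ (jacobiImage (c k) (φ k) m) f = z * inner ℂ (φ k m) f := by
  rw [CubicGenerator.mem_deficiencySubspace_iff]
  refine ⟨fun hf k m => hf _ _ (h.graph_mem k m), fun hf x y hxy => ?_⟩
  refine h.graph_induction (fun p => inner ℂ p.2 f = z * inner ℂ p.1 f) hf (by simp) ?_ ?_ hxy
  · intro p q hp hq
    simp [hp, hq, mul_add]
  · intro a p hp
    simp only [Prod.smul_fst, Prod.smul_snd, inner_smul_left, hp]
    ring

theorem isSymmetricOperator (h : HasJacobiSectors T φ c) : IsSymmetricOperator T := by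
  refine ⟨h.dense, fun x y => ?_⟩
  have key : ∀ l n, inner ℂ (T x) (φ l n) = inner ℂ (x : H) (jacobiImage (c l) (φ l) n) := by
    intro l n
    refine h.graph_induction
      (fun p => inner ℂ p.2 (φ l n) = inner ℂ p.1 (jacobiImage (c l) (φ l) n))
      (fun k m => inner_jacobiImage_comm h.orthonormal c k l m n) (by simp) ?_ ?_
      (T.mem_graph x)
    · intro p q hp hq
      simp [hp, hq]
    · intro a p hp
      simp [hp]
  refine h.graph_induction (fun p => inner ℂ (T x) p.1 = inner ℂ (x : H) p.2) key (by simp) ?_ ?_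
      (T.mem_graph y)
  · intro p q hp hq
    simp [hp, hq]
  · intro a p hp
    simp [hp]

end HasJacobiSectors

/-! ### The Jacobi operator in `ℓ²(ℕ)` -/

theorem inner_lp_single_left (m : ℕ) (f : EllTwo) :
    inner ℂ (lp.single 2 m (1 : ℂ) : EllTwo) f = f m := by
  rw [lp.inner_single_left]
  simp

theorem finSeq_single (m : ℕ) (a : ℂ) :
    finSeq (Finsupp.single m a) = a • (lp.single 2 m (1 : ℂ) : EllTwo) := by
  simp [finSeq]

theorem jacobiMatrix_single_one (c : ℕ → ℂ) (m : ℕ) :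
    jacobiMatrix c (Finsupp.single m 1) = jacobiImage c (fun k => Finsupp.single k (1 : ℂ)) m := by
  cases m <;> simp [jacobiMatrix, jacobiImage]

theorem realize_graph_iff {V : Type*} [AddCommGroup V] [Module ℂ V] (ι : V →ₗ[ℂ] H)
    (hι : Function.Injective ι) (D : Submodule ℂ V) (A : V →ₗ[ℂ] V) (x y : H) :
    (x, y) ∈ (realize ι hι D A).graph ↔ ∃ v ∈ D, ι v = x ∧ ι (A v) = y := by
  rw [LinearPMap.mem_graph_iff]
  constructor
  · rintro ⟨⟨_, v, hv, rfl⟩, rfl, rfl⟩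
    exact ⟨v, hv, rfl, (realize_apply ι hι D A v hv).symm⟩
  · rintro ⟨v, hv, rfl, rfl⟩
    exact ⟨⟨ι v, Submodule.mem_map_of_mem hv⟩, rfl, realize_apply ι hι D A v hv⟩

theorem jacobiOperator_domain (c : ℕ → ℂ) :
    (jacobiOperator c).domain =
      Submodule.span ℂ (Set.range fun m : ℕ => (lp.single 2 m (1 : ℂ) : EllTwo)) := by
  change Submodule.map finSeq ⊤ = _
  rw [Submodule.map_top, finSeq, Finsupp.range_linearCombination]

theorem jacobiOperator_graph_single (c : ℕ → ℂ) (m : ℕ) :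
    ((lp.single 2 m (1 : ℂ) : EllTwo), jacobiImage c (fun k => (lp.single 2 k (1 : ℂ) : EllTwo)) m)
      ∈ (jacobiOperator c).graph := by
  refine (realize_graph_iff _ _ _ _ _ _).mpr
    ⟨Finsupp.single m 1, trivial, by rw [finSeq_single, one_smul], ?_⟩
  rw [jacobiMatrix_single_one, map_jacobiImage]
  simp [finSeq_single]

theorem orthonormal_lp_single :
    Orthonormal ℂ fun m : ℕ => (lp.single 2 m (1 : ℂ) : EllTwo) := by
  rw [orthonormal_iff_ite]
  intro m n
  rw [inner_lp_single_left]
  by_cases h : m = n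
  · subst h; simp
  · simp [h]

theorem jacobiOperator_hasJacobiSectors (c : ℕ → ℂ) :
    HasJacobiSectors (jacobiOperator c)
      (fun (_ : Unit) m => (lp.single 2 m (1 : ℂ) : EllTwo)) (fun _ => c) where
  orthonormal := orthonormal_lp_single.comp (fun k : Unit × ℕ => k.2) fun a b h => by
    ext; exact h
  dense := by
    rw [jacobiOperator_domain, Submodule.dense_iff_topologicalClosure_eq_top,
      Submodule.topologicalClosure_eq_top_iff, Submodule.eq_bot_iff]
    intro f hf
    ext m
    have := (Submodule.mem_orthogonal _ _).mp hf _ (Submodule.subset_span ⟨m, rfl⟩)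
    rwa [inner_lp_single_left] at this
  domain_eq := by
    rw [jacobiOperator_domain]
    congr 1
    ext x
    simp
  graph_mem := fun _ m => jacobiOperator_graph_single c m

theorem mem_deficiencySubspace_jacobiOperator_iff (c : ℕ → ℂ) (z : ℂ) (f : EllTwo) :
    f ∈ deficiencySubspace (jacobiOperator c) z ↔
      conj (c 0) * f 1 = z * f 0 ∧
      ∀ m, conj (c (m + 1)) * f (m + 2) + c m * f m = z * f (m + 1) := by
  rw [(jacobiOperator_hasJacobiSectors c).mem_deficiencySubspace_iff]
  simp only [forall_const]
  refine Nat.and_forall_add_one.symm.trans ?_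
  simp only [inner_jacobiImage_zero, inner_jacobiImage_succ,
    inner_lp_single_left]

/-! ### Embedding the sectors into the whole space -/

namespace HasJacobiSectors

variable {T : H →ₗ.[ℂ] H} {φ : κ → ℕ → H} {c : κ → ℕ → ℂ}

theorem orthonormal_sector (h : HasJacobiSectors T φ c) (k : κ) : Orthonormal ℂ (φ k) :=
  h.orthonormal.comp (fun m : ℕ => (k, m)) fun a b hab => by simpa using hab

/-- This recovers finiteness of a sequence from the fact that its image lies in the domain of `T`.
-/
theorem finite_inner_ne_zero (h : HasJacobiSectors T φ c) (k : κ) {x : H} (hx : x ∈ T.domain) :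
    {m : ℕ | inner ℂ (φ k m) x ≠ (0 : ℂ)}.Finite := by
  rw [h.domain_eq] at hx
  induction hx using Submodule.span_induction with
  | mem x hx =>
    obtain ⟨⟨l, n⟩, rfl⟩ := hx
    refine (Set.finite_singleton n).subset fun m hm => ?_
    by_contra hmn
    exact hm (h.orthonormal.2 (i := (k, m)) (j := (l, n)) fun heq => hmn (congrArg Prod.snd heq))
  | zero => simp
  | add x y _ _ hx hy =>
    refine (hx.union hy).subset fun m hm => ?_
    by_contra hmn
    simp only [Set.mem_union, Set.mem_ofPred_eq, not_or, not_not] at hmn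
    exact hm (by rw [inner_add_right, hmn.1, hmn.2, add_zero])
  | smul a x _ hx =>
    refine hx.subset fun m hm hm' => hm (by rw [inner_smul_right, hm', mul_zero])

variable [CompleteSpace H]

/-- The isometry of `ℓ²(ℕ)` onto the closed span of one sector. -/
def sectorIsometry (h : HasJacobiSectors T φ c) (k : κ) : EllTwo →ₗᵢ[ℂ] H :=
  (h.orthonormal_sector k).orthogonalFamily.linearIsometry

theorem sectorIsometry_single (h : HasJacobiSectors T φ c) (k : κ) (m : ℕ) :
    h.sectorIsometry k (lp.single 2 m (1 : ℂ)) = φ k m := by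
  simp [sectorIsometry]

theorem inner_sectorIsometry (h : HasJacobiSectors T φ c) (k : κ) (m : ℕ) (u : EllTwo) :
    inner ℂ (φ k m) (h.sectorIsometry k u) = u m := by
  rw [← h.sectorIsometry_single k m, LinearIsometry.inner_map_map, inner_lp_single_left]

theorem inner_sectorIsometry_of_ne (h : HasJacobiSectors T φ c) {k l : κ} (hkl : k ≠ l) (m : ℕ)
    (u : EllTwo) : inner ℂ (φ l m) (h.sectorIsometry k u) = 0 := by
  have hs := ((h.orthonormal_sector k).orthogonalFamily.hasSum_linearIsometry u).mapL
    (innerSL ℂ (φ l m))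
  refine hs.unique ?_
  convert hasSum_zero with i
  have := h.orthonormal.2 (i := (l, m)) (j := (k, i)) (by simp [Ne.symm hkl])
  simp [this]

theorem inner_sectorIsometry_sectorIsometry_of_ne (h : HasJacobiSectors T φ c) {k l : κ}
    (hkl : k ≠ l) (u v : EllTwo) :
    inner ℂ (h.sectorIsometry k u) (h.sectorIsometry l v) = 0 := by
  have hs := ((h.orthonormal_sector l).orthogonalFamily.hasSum_linearIsometry v).mapL
    (innerSL ℂ (h.sectorIsometry k u))
  refine hs.unique ?_
  convert hasSum_zero with i
  have := inner_eq_zero_symm.mp (h.inner_sectorIsometry_of_ne hkl i u)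
  simp [this]

/-- Tested in its own sector, the image satisfies the recurrence of `u`; tested in any other sector,
both sides vanish by orthogonality. -/
theorem sectorIsometry_mem_deficiencySubspace (h : HasJacobiSectors T φ c) (k : κ) {z : ℂ}
    {u : EllTwo} (hu : u ∈ deficiencySubspace (jacobiOperator (c k)) z) :
    h.sectorIsometry k u ∈ deficiencySubspace T z := by
  rw [mem_deficiencySubspace_jacobiOperator_iff] at hu
  rw [h.mem_deficiencySubspace_iff]
  intro l m
  by_cases hkl : k = l
  · subst hkl
    rcases m with _ | m <;>
      simp only [inner_jacobiImage_zero, inner_jacobiImage_succ, inner_sectorIsometry, hu]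
  · cases m <;>
      simp [inner_jacobiImage_zero, inner_jacobiImage_succ, h.inner_sectorIsometry_of_ne hkl]

/-- One nonzero deficiency vector from each sector yields an infinite orthogonal, hence linearly
independent, family. -/
theorem deficiencyDim_eq_top [Infinite κ] (h : HasJacobiSectors T φ c) {z : ℂ}
    (hz : ∀ k, deficiencySubspace (jacobiOperator (c k)) z ≠ ⊥) : deficiencyDim T z = ⊤ := by
  choose u hu hu0 using fun k => Submodule.exists_mem_ne_zero_of_ne_bot (hz k)
  let v : κ → deficiencySubspace T z := fun k =>
    ⟨h.sectorIsometry k (u k), h.sectorIsometry_mem_deficiencySubspace k (hu k)⟩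
  have hv : LinearIndependent ℂ v := by
    refine linearIndependent_of_ne_zero_of_inner_eq_zero (fun k hk => hu0 k ?_) fun k l hkl => ?_
    · exact (map_eq_zero_iff _ (h.sectorIsometry k).injective).mp (congrArg Subtype.val hk)
    · exact h.inner_sectorIsometry_sectorIsometry_of_ne hkl _ _
  rw [deficiencyDim, Cardinal.toENat_eq_top]
  exact Cardinal.aleph0_le_lift.mp
    ((Cardinal.aleph0_le_lift.mpr (Cardinal.aleph0_le_mk κ)).trans hv.cardinal_lift_le_rank)

theorem not_isEssentiallySelfAdjoint (h : HasJacobiSectors T φ c) {z : ℂ} (hz : z.im ≠ 0) (k : κ)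
    (hk : deficiencySubspace (jacobiOperator (c k)) z ≠ ⊥) : ¬ IsEssentiallySelfAdjoint T := by
  intro hT
  obtain ⟨u, hu, hu0⟩ := Submodule.exists_mem_ne_zero_of_ne_bot hk
  refine hu0 ((map_eq_zero_iff _ (h.sectorIsometry k).injective).mp ?_)
  exact eq_zero_of_mem_deficiencySubspace hT hz (h.sectorIsometry_mem_deficiencySubspace k hu)

theorem sectorIsometry_mem_graph (h : HasJacobiSectors T φ c) (k : κ) {u w : EllTwo}
    (huw : (u, w) ∈ (jacobiOperator (c k)).graph) :
    (h.sectorIsometry k u, h.sectorIsometry k w) ∈ T.graph := by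
  refine (jacobiOperator_hasJacobiSectors (c k)).graph_induction
    (fun p => (h.sectorIsometry k p.1, h.sectorIsometry k p.2) ∈ T.graph) ?_ ?_ ?_ ?_ huw
  · intro _ m
    have := map_jacobiImage (h.sectorIsometry k).toLinearMap (c k)
      (fun m => (lp.single 2 m (1 : ℂ) : EllTwo)) m
    simp only [LinearIsometry.coe_toLinearMap, sectorIsometry_single] at this
    simp only [this, sectorIsometry_single]
    exact h.graph_mem k m
  · simp
  · intro p q hp hq
    simpa using T.graph.add_mem hp hq
  · intro a p hp
    simpa using T.graph.smul_mem a hp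

theorem sectorIsometry_mem_domain_iff (h : HasJacobiSectors T φ c) (k : κ) (u : EllTwo) :
    h.sectorIsometry k u ∈ T.domain ↔ u ∈ (jacobiOperator (c k)).domain := by
  constructor
  · intro hu
    have hfin := h.finite_inner_ne_zero k hu
    simp only [inner_sectorIsometry] at hfin
    refine ⟨Finsupp.ofSupportFinite (fun m => u m) hfin, trivial, ?_⟩
    ext m
    rw [finSeq_apply]
    rfl
  · intro hu
    exact LinearPMap.mem_domain_of_mem_graph (h.sectorIsometry_mem_graph k
      ((jacobiOperator (c k)).mem_graph ⟨u, hu⟩))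

end HasJacobiSectors

theorem HasJacobiSectors.actsAsJacobi {T : LTwo →ₗ.[ℂ] LTwo} {φ : κ → ℕ → LTwo} {c : κ → ℕ → ℂ}
    (h : HasJacobiSectors T φ c) (k : κ) : ActsAsJacobi T (φ k) (c k) :=
  ⟨h.sectorIsometry k, h.sectorIsometry_single k, h.sectorIsometry_mem_domain_iff k,
    fun _ _ => h.sectorIsometry_mem_graph k⟩

end JacobiSectors


/-! ### Berezanskii's criterion and the deficiency indices of the sectors -/

section Recurrence

/-- A discrete Grönwall argument: the maximum of two consecutive terms grows by a factor of at most
`1 + ε k ≤ exp (ε k)` per step, and the product of these factors stays bounded. -/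
theorem bddAbove_of_le_one_add_mul {v ε : ℕ → ℝ} (hv : ∀ k, 0 ≤ v k) (hε : ∀ k, 0 ≤ ε k)
    (hs : Summable ε) (h : ∀ k, v (k + 2) ≤ ε k * v (k + 1) + v k) : ∃ B, ∀ k, v k ≤ B := by
  have key : ∀ k, max (v k) (v (k + 1)) ≤
      max (v 0) (v 1) * Real.exp (∑ i ∈ Finset.range k, ε i) := by
    intro k
    induction k with
    | zero => simp
    | succ k ih =>
      have hM : max (v (k + 1)) (v (k + 2)) ≤ (ε k + 1) * max (v k) (v (k + 1)) := by
        have h0 : 0 ≤ max (v k) (v (k + 1)) := (hv k).trans (le_max_left _ _)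
        have h1 := mul_le_mul_of_nonneg_left (le_max_right (v k) (v (k + 1))) (hε k)
        have h2 := mul_nonneg (hε k) h0
        refine max_le ?_ ?_
        · linarith [le_max_right (v k) (v (k + 1))]
        · linarith [h k, le_max_left (v k) (v (k + 1))]
      rw [Finset.sum_range_succ, Real.exp_add]
      calc _ ≤ (ε k + 1) * max (v k) (v (k + 1)) := hM
        _ ≤ Real.exp (ε k) *
            (max (v 0) (v 1) * Real.exp (∑ i ∈ Finset.range k, ε i)) :=
          mul_le_mul (Real.add_one_le_exp _) ih ((hv k).trans (le_max_left _ _))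
            (Real.exp_pos _).le
        _ = _ := by ring
  refine ⟨max (v 0) (v 1) * Real.exp (∑' i, ε i), fun k => ?_⟩
  refine (le_max_left _ _).trans ((key k).trans ?_)
  have := hs.sum_le_tsum (Finset.range k) fun i _ => hε i
  have h0 : 0 ≤ max (v 0) (v 1) := (hv 0).trans (le_max_left _ _)
  gcongr

/-- Berezanskii's criterion: if the moduli of the off-diagonal entries are log-concave with
summable inverses, then all solutions of the recurrence are square-summable. -/
theorem summable_norm_sq_of_recurrence {d p : ℕ → ℂ} {z : ℂ} {C : ℝ} (hd : ∀ k, d k ≠ 0)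
    (hlog : ∀ k, ‖d k‖ * ‖d (k + 2)‖ ≤ ‖d (k + 1)‖ ^ 2) (hC : ∀ k, ‖d (k + 1)‖ ≤ C * ‖d k‖)
    (hs : Summable fun k => ‖d k‖⁻¹)
    (hp : ∀ k, conj (d (k + 1)) * p (k + 2) + d k * p k = z * p (k + 1)) :
    Summable fun k => ‖p k‖ ^ 2 := by
  have ha : ∀ k, 0 < ‖d k‖ := fun k => norm_pos_iff.mpr (hd k)
  have hC0 : 0 ≤ C := by
    by_contra hneg
    have := hC 0
    nlinarith [ha 0, ha 1]
  -- The weight `√‖d k‖` is chosen so that, after multiplying the recurrence by `√‖d (k + 2)‖ / ‖d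
  -- (k + 1)‖`, log-concavity bounds the coefficient of `v k` by `1`, while the ratio bound `C`
  -- makes the coefficient of `v (k + 1)` summable.
  obtain ⟨B, hB⟩ := bddAbove_of_le_one_add_mul (v := fun k => √‖d k‖ * ‖p k‖)
    (ε := fun k => ‖z‖ * √C * ‖d (k + 1)‖⁻¹) (fun k => by positivity) (fun k => by positivity)
    (((summable_nat_add_iff 1).mpr hs).mul_left _) (fun k => by
      have h1 : ‖d (k + 1)‖ * ‖p (k + 2)‖ ≤ ‖z‖ * ‖p (k + 1)‖ + ‖d k‖ * ‖p k‖ := by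
        have h : conj (d (k + 1)) * p (k + 2) = z * p (k + 1) - d k * p k := by
          rw [← hp k]; ring
        calc _ = ‖conj (d (k + 1)) * p (k + 2)‖ := by simp
          _ ≤ _ := by
            rw [h]
            exact (norm_sub_le _ _).trans_eq (by simp)
      have h2 : √‖d (k + 2)‖ ≤ √C * √‖d (k + 1)‖ := by
        rw [← Real.sqrt_mul hC0]
        exact Real.sqrt_le_sqrt (hC (k + 1))
      have h3 : √‖d (k + 2)‖ * √‖d k‖ ≤ ‖d (k + 1)‖ := by
        rw [← Real.sqrt_mul (ha _).le, mul_comm]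
        exact (Real.sqrt_le_left (ha _).le).mpr (hlog k)
      have h4 : √‖d k‖ * √‖d k‖ = ‖d k‖ := Real.mul_self_sqrt (ha k).le
      have ha1 := ha (k + 1)
      rw [← mul_le_mul_iff_right₀ ha1]
      calc ‖d (k + 1)‖ * (√‖d (k + 2)‖ * ‖p (k + 2)‖)
          = √‖d (k + 2)‖ * (‖d (k + 1)‖ * ‖p (k + 2)‖) := by ring
        _ ≤ √‖d (k + 2)‖ * (‖z‖ * ‖p (k + 1)‖ + ‖d k‖ * ‖p k‖) := by gcongr
        _ = √‖d (k + 2)‖ * (‖z‖ * ‖p (k + 1)‖) +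
            (√‖d (k + 2)‖ * √‖d k‖) * (√‖d k‖ * ‖p k‖) := by
          linear_combination -(√‖d (k + 2)‖ * ‖p k‖) * h4
        _ ≤ (√C * √‖d (k + 1)‖) * (‖z‖ * ‖p (k + 1)‖) +
            ‖d (k + 1)‖ * (√‖d k‖ * ‖p k‖) := by gcongr
        _ = _ := by field_simp)
  -- Boundedness of the weighted sequence means `‖p k‖ ^ 2 ≤ B ^ 2 / ‖d k‖`.
  refine Summable.of_nonneg_of_le (fun k => by positivity) (fun k => ?_) (hs.mul_left (B ^ 2))
  have h := pow_le_pow_left₀ (by positivity) (hB k) 2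
  rw [mul_pow, Real.sq_sqrt (ha k).le] at h
  rw [← div_eq_mul_inv, le_div_iff₀ (ha k), mul_comm]
  exact h

/-- The solution of the three-term recurrence with initial value `1`. -/
def jacobiSolution (d : ℕ → ℂ) (z : ℂ) : ℕ → ℂ
  | 0 => 1
  | 1 => z / conj (d 0)
  | k + 2 => (z * jacobiSolution d z (k + 1) - d k * jacobiSolution d z k) / conj (d (k + 1))

theorem jacobiSolution_one {d : ℕ → ℂ} (hd : ∀ k, d k ≠ 0) (z : ℂ) :
    conj (d 0) * jacobiSolution d z 1 = z * jacobiSolution d z 0 := by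
  have : conj (d 0) ≠ 0 := (map_ne_zero _).mpr (hd _)
  simp only [jacobiSolution]
  field_simp

theorem jacobiSolution_add_two {d : ℕ → ℂ} (hd : ∀ k, d k ≠ 0) (z : ℂ) (k : ℕ) :
    conj (d (k + 1)) * jacobiSolution d z (k + 2) + d k * jacobiSolution d z k =
      z * jacobiSolution d z (k + 1) := by
  have : conj (d (k + 1)) ≠ 0 := (map_ne_zero _).mpr (hd _)
  rw [jacobiSolution]
  field_simp
  ring

theorem eq_mul_jacobiSolution {d : ℕ → ℂ} (hd : ∀ k, d k ≠ 0) {z : ℂ} {f : ℕ → ℂ}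
    (h0 : conj (d 0) * f 1 = z * f 0)
    (h : ∀ k, conj (d (k + 1)) * f (k + 2) + d k * f k = z * f (k + 1)) (k : ℕ) :
    f k = f 0 * jacobiSolution d z k := by
  have key : f k = f 0 * jacobiSolution d z k ∧ f (k + 1) = f 0 * jacobiSolution d z (k + 1) := by
    induction k with
    | zero =>
      refine ⟨by simp [jacobiSolution],
        mul_left_cancel₀ ((map_ne_zero (starRingEnd ℂ)).mpr (hd 0)) ?_⟩
      rw [h0, mul_left_comm, jacobiSolution_one hd]
      simp [jacobiSolution, mul_comm]
    | succ k ih =>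
      refine ⟨ih.2, mul_left_cancel₀ ((map_ne_zero (starRingEnd ℂ)).mpr (hd (k + 1))) ?_⟩
      linear_combination h k - f 0 * jacobiSolution_add_two hd z k - d k * ih.1 + z * ih.2
  exact key.1

/-- The sequence that vanishes below `N` and continues with the solution of the recurrence
started at `N`. -/
def shiftedSolution (c : ℕ → ℂ) (z : ℂ) (N m : ℕ) : ℂ :=
  if m < N then 0 else jacobiSolution (fun k => c (N + k)) z (m - N)

theorem shiftedSolution_add (c : ℕ → ℂ) (z : ℂ) (N k : ℕ) :
    shiftedSolution c z N (N + k) = jacobiSolution (fun k => c (N + k)) z k := by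
  simp [shiftedSolution]

theorem shiftedSolution_of_lt (c : ℕ → ℂ) (z : ℂ) {N m : ℕ} (h : m < N) :
    shiftedSolution c z N m = 0 := by
  simp [shiftedSolution, h]

/-- The vanishing entry just before `N` (no condition if `N = 0`) decouples the matrix. Deficiency
vectors vanish on the block below `N`, and from `N` on they are determined by their value there;
square-summability of the normalized solution makes it an actual deficiency vector. -/
theorem deficiencyDim_jacobiOperator_eq_one {c : ℕ → ℂ} {z : ℂ} {N : ℕ}
    (hN : ∀ m, m + 1 = N → c m = 0) (hne : ∀ k, c (N + k) ≠ 0)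
    (hs : Summable fun k => ‖jacobiSolution (fun k => c (N + k)) z k‖ ^ 2)
    (hlow : ∀ f ∈ deficiencySubspace (jacobiOperator c) z, ∀ m < N, f m = 0) :
    deficiencyDim (jacobiOperator c) z = 1 := by
  have hmem : Memℓp (fun m => shiftedSolution c z N m) 2 := by
    refine memℓp_gen ?_
    simp only [ENNReal.toReal_ofNat, Real.rpow_ofNat]
    rw [← summable_nat_add_iff N]
    simpa only [add_comm _ N, shiftedSolution_add] using hs
  let w : EllTwo := ⟨_, hmem⟩
  have hw : ∀ m, w m = shiftedSolution c z N m := fun m => rfl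
  have hwN : ∀ k, w (N + k) = jacobiSolution (fun k => c (N + k)) z k :=
    shiftedSolution_add c z N
  have hwlt : ∀ m, m < N → w m = 0 := fun m => shiftedSolution_of_lt c z
  have hw0 : w ≠ 0 := by
    intro h
    have := hwN 0
    rw [h] at this
    simp [jacobiSolution] at this
  have hspan : deficiencySubspace (jacobiOperator c) z = Submodule.span ℂ {w} := by
    refine le_antisymm (fun f hf => ?_) ?_
    · rw [Submodule.mem_span_singleton]
      have hlow' := hlow f hf
      rw [mem_deficiencySubspace_jacobiOperator_iff] at hf
      refine ⟨f N, ?_⟩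
      ext m
      rw [lp.coeFn_smul, Pi.smul_apply, smul_eq_mul]
      rcases lt_or_ge m N with hm | hm
      · rw [hwlt m hm, hlow' m hm, mul_zero]
      · obtain ⟨k, rfl⟩ := Nat.exists_eq_add_of_le hm
        rw [hwN]
        refine (eq_mul_jacobiSolution (f := fun k => f (N + k)) hne ?_
          (fun k => hf.2 (N + k)) k).symm
        -- The initial relation of the tail is row `0` of the matrix if `N = 0`; otherwise it is row
        -- `N`, which has lost its lower neighbour.
        rcases N with _ | N
        · simpa using hf.1
        · have := hf.2 N
          rw [hN N rfl, zero_mul, add_zero] at this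
          exact this
    · rw [Submodule.span_singleton_le_iff_mem, mem_deficiencySubspace_jacobiOperator_iff]
      have h1 := jacobiSolution_one hne z
      rw [← hwN, ← hwN] at h1
      refine ⟨?_, fun m => ?_⟩
      · rcases N with _ | _ | N
        · simpa using h1
        · rw [hN 0 rfl, hwlt 0 (by omega)]; simp
        · rw [hwlt 0 (by omega), hwlt 1 (by omega)]; simp
      · rcases lt_or_ge m N with hm | hm
        · rw [hwlt m hm, mul_zero, add_zero]
          -- Row `m + 1` is the first row of the tail, the last row of the block (whose coupling to
          -- the tail is zero), or lies inside the block.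
          rcases (show m + 1 = N ∨ m + 2 = N ∨ m + 2 < N by omega) with h | h | h
          · subst h
            exact h1
          · rw [hN (m + 1) h, hwlt (m + 1) (by omega)]; simp
          · rw [hwlt (m + 1) (by omega), hwlt (m + 2) h]; simp
        · obtain ⟨k, rfl⟩ := Nat.exists_eq_add_of_le hm
          have := jacobiSolution_add_two hne z k
          rw [← hwN, ← hwN, ← hwN] at this
          exact this
  have hrank : Module.rank ℂ (Submodule.span ℂ {w}) = 1 := by
    rw [← Module.finrank_eq_rank, finrank_span_singleton hw0, Nat.cast_one]
  rw [deficiencyDim, hspan, hrank]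
  simp

/-! ### Estimates for the matrix entries -/

theorem beta_eq_zero_iff (n m : ℕ) : β n m = 0 ↔ m + n = 1 := by
  have h : √((m : ℝ) + 1) ≠ 0 := by positivity
  simp only [β, mul_eq_zero, h, or_false, div_eq_zero_iff, one_ne_zero, OfNat.ofNat_ne_zero,
    false_or]
  rw [sub_sub, sub_eq_zero, ← Nat.cast_add, eq_comm, Nat.cast_eq_one]

theorem abs_beta_of_le {n m : ℕ} (h : 1 ≤ m + n) :
    |β n m| = 1 / 2 * √((m : ℝ) + 1) * ((m : ℝ) + n - 1) := by
  have h' : (1 : ℝ) ≤ (m : ℝ) + n := by exact_mod_cast h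
  rw [β, abs_mul, abs_of_nonneg (by positivity), abs_of_nonpos (by linarith)]
  ring

/-- Since `N + n ≥ 2`, the modulus is at least `(k + 1) ^ (3/2) / 2`. -/
theorem summable_inv_abs_beta (n N : ℕ) (h : 2 ≤ N + n) :
    Summable fun k : ℕ => |β n (N + k)|⁻¹ := by
  have hs : Summable fun k : ℕ => 2 * (((k + 1 : ℕ) : ℝ) ^ (3 / 2 : ℝ))⁻¹ :=
    ((summable_nat_add_iff 1).mpr
      (Real.summable_nat_rpow_inv.mpr (by norm_num : (1 : ℝ) < 3 / 2))).mul_left 2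
  refine Summable.of_nonneg_of_le (fun k => by positivity) (fun k => ?_) hs
  have h' : (2 : ℝ) ≤ (N : ℝ) + n := by exact_mod_cast h
  have hk : (0 : ℝ) ≤ k := k.cast_nonneg
  have hN : (0 : ℝ) ≤ N := N.cast_nonneg
  have hpow : ((k + 1 : ℕ) : ℝ) ^ (3 / 2 : ℝ) = √((k : ℝ) + 1) * ((k : ℝ) + 1) := by
    rw [show (3 / 2 : ℝ) = 1 / 2 + 1 by norm_num, Real.rpow_add (by positivity), Real.rpow_one,
      ← Real.sqrt_eq_rpow]
    push_cast
    rfl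
  have hle : 1 / 2 * (√((k : ℝ) + 1) * ((k : ℝ) + 1)) ≤ |β n (N + k)| := by
    rw [abs_beta_of_le (by omega), mul_assoc]
    push_cast
    gcongr <;> linarith
  rw [hpow]
  calc |β n (N + k)|⁻¹ ≤ (1 / 2 * (√((k : ℝ) + 1) * ((k : ℝ) + 1)))⁻¹ := by gcongr
    _ = _ := by rw [mul_inv]; norm_num

/-- Both factors, `√(m + 1)` and `m + n - 1`, are log-concave by the inequality of arithmetic and
geometric means. -/
theorem abs_beta_mul_le (n m : ℕ) (h : 2 ≤ m + n) :
    |β n m| * |β n (m + 2)| ≤ |β n (m + 1)| ^ 2 := by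
  rw [abs_beta_of_le (by omega), abs_beta_of_le (by omega), abs_beta_of_le (by omega)]
  have h' : (2 : ℝ) ≤ (m : ℝ) + n := by exact_mod_cast h
  have hm : (0 : ℝ) ≤ m := m.cast_nonneg
  push_cast
  have h1 : √((m : ℝ) + 1) * √((m : ℝ) + 2 + 1) ≤ (m : ℝ) + 1 + 1 := by
    rw [← Real.sqrt_mul (by positivity), Real.sqrt_le_left (by positivity)]
    nlinarith
  have h2 : ((m : ℝ) + n - 1) * ((m : ℝ) + 2 + n - 1) ≤ ((m : ℝ) + 1 + n - 1) ^ 2 := by nlinarith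
  have h3 : 0 ≤ ((m : ℝ) + n - 1) * ((m : ℝ) + 2 + n - 1) :=
    mul_nonneg (by linarith) (by linarith)
  have hsq : √((m : ℝ) + 1 + 1) ^ 2 = (m : ℝ) + 1 + 1 := Real.sq_sqrt (by positivity)
  calc _ = 1 / 4 * ((√((m : ℝ) + 1) * √((m : ℝ) + 2 + 1)) *
        (((m : ℝ) + n - 1) * ((m : ℝ) + 2 + n - 1))) := by ring
    _ ≤ 1 / 4 * (((m : ℝ) + 1 + 1) * ((m : ℝ) + 1 + n - 1) ^ 2) := by gcongr
    _ = _ := by linear_combination -(1 / 4 * ((m : ℝ) + 1 + n - 1) ^ 2) * hsq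

theorem abs_beta_succ_le (n m : ℕ) (h : 2 ≤ m + n) : |β n (m + 1)| ≤ 4 * |β n m| := by
  rw [abs_beta_of_le (by omega), abs_beta_of_le (by omega)]
  have h' : (2 : ℝ) ≤ (m : ℝ) + n := by exact_mod_cast h
  have hm : (0 : ℝ) ≤ m := m.cast_nonneg
  push_cast
  have h1 : √((m : ℝ) + 1 + 1) ≤ 2 * √((m : ℝ) + 1) := by
    rw [Real.sqrt_le_left (by positivity), mul_pow, Real.sq_sqrt (by positivity)]
    linarith
  calc 1 / 2 * √((m : ℝ) + 1 + 1) * ((m : ℝ) + 1 + n - 1)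
      ≤ 1 / 2 * (2 * √((m : ℝ) + 1)) * (2 * ((m : ℝ) + n - 1)) := by
        gcongr
        · linarith
        · linarith
    _ = _ := by ring

/-- A two-by-two Hermitian matrix has no non-real eigenvalue: here an eigenvalue would satisfy `z *
z = |a| ^ 2`, but a real square of a non-real number is negative. -/
theorem eq_zero_of_mul_eq_conj_mul {a x y z : ℂ} (hz : z.im ≠ 0) (h1 : conj a * y = z * x)
    (h2 : a * x = z * y) : x = 0 ∧ y = 0 := by
  have hz0 : z ≠ 0 := fun h => hz (by simp [h])
  have hy : y = 0 := by
    by_contra hy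
    have h : (z * z - (Complex.normSq a : ℂ)) * y = 0 := by
      rw [← Complex.mul_conj]
      linear_combination -z * h2 - a * h1
    have h3 : z * z = (Complex.normSq a : ℂ) := sub_eq_zero.mp ((mul_eq_zero.mp h).resolve_right hy)
    have him := congrArg Complex.im h3
    have hre := congrArg Complex.re h3
    simp only [Complex.mul_im, Complex.ofReal_im, Complex.mul_re, Complex.ofReal_re] at him hre
    have hre0 : z.re = 0 := by
      have : z.im * z.re = 0 := by linarith
      exact (mul_eq_zero.mp this).resolve_left hz
    rw [hre0] at hre
    have := Complex.normSq_nonneg a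
    have := mul_self_pos.mpr hz
    linarith
  refine ⟨?_, hy⟩
  rw [hy, mul_zero] at h1
  exact (mul_eq_zero.mp h1.symm).resolve_left hz0

theorem deficiencyDim_jacobiOperator_of_norm_eq_abs_beta {c : ℕ → ℂ} {n : ℕ}
    (hc : ∀ m, ‖c m‖ = |β n m|) {z : ℂ} (hz : z.im ≠ 0) :
    deficiencyDim (jacobiOperator c) z = 1 := by
  have hc0 : ∀ m, c m = 0 ↔ m + n = 1 := fun m => by
    rw [← norm_eq_zero, hc, abs_eq_zero, beta_eq_zero_iff]
  have hz0 : z ≠ 0 := fun h => hz (by simp [h])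
  -- With truncated subtraction the tail starts at `2 - n`: the finite block has size two for `n =
  -- 0`, size one for `n = 1`, and is empty for `n ≥ 2`.
  have hne : ∀ k, c (2 - n + k) ≠ 0 := fun k => by rw [Ne, hc0]; omega
  refine deficiencyDim_jacobiOperator_eq_one (N := 2 - n) (fun m hm => ?_) hne ?_
    fun f hf m hm => ?_
  · rw [hc0]; omega
  · refine summable_norm_sq_of_recurrence (C := 4) hne (fun k => ?_) (fun k => ?_) ?_
      (jacobiSolution_add_two hne z)
    · simp only [hc]
      exact abs_beta_mul_le n (2 - n + k) (by omega)
    · simp only [hc]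
      exact abs_beta_succ_le n (2 - n + k) (by omega)
    · simp only [hc]
      exact summable_inv_abs_beta n (2 - n) (by omega)
  · obtain ⟨h0, h1⟩ := (mem_deficiencySubspace_jacobiOperator_iff c z f).mp hf
    obtain rfl | rfl : n = 0 ∨ n = 1 := by omega
    · have h2 := h1 0
      rw [(hc0 1).mpr rfl, map_zero, zero_mul, zero_add] at h2
      obtain ⟨hx, hy⟩ := eq_zero_of_mul_eq_conj_mul hz h0 h2
      obtain rfl | rfl : m = 0 ∨ m = 1 := by omega
      exacts [hx, hy]
    · rw [(hc0 0).mpr rfl, map_zero, zero_mul] at h0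
      obtain rfl : m = 0 := by omega
      exact (mul_eq_zero.mp h0.symm).resolve_left hz0

theorem hasDeficiencyIndices_jacobiOperator {c : ℕ → ℂ} {n : ℕ}
    (hc : ∀ m, ‖c m‖ = |β n m|) : HasDeficiencyIndices (jacobiOperator c) 1 1 :=
  ⟨fun _ hz => deficiencyDim_jacobiOperator_of_norm_eq_abs_beta hc hz.ne',
    fun _ hz => deficiencyDim_jacobiOperator_of_norm_eq_abs_beta hc hz.ne⟩

theorem deficiencySubspace_jacobiOperator_ne_bot {c : ℕ → ℂ} {n : ℕ}
    (hc : ∀ m, ‖c m‖ = |β n m|) {z : ℂ} (hz : z.im ≠ 0) :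
    deficiencySubspace (jacobiOperator c) z ≠ ⊥ := by
  intro h
  have := deficiencyDim_jacobiOperator_of_norm_eq_abs_beta hc hz
  rw [deficiencyDim, h] at this
  simp at this

theorem HasJacobiSectors.main_properties {H : Type*} [NormedAddCommGroup H]
    [InnerProductSpace ℂ H] [CompleteSpace H] {T : H →ₗ.[ℂ] H} {φ : ℕ → ℕ → H} {c : ℕ → ℕ → ℂ}
    (h : HasJacobiSectors T φ c) (hc : ∀ n m, ‖c n m‖ = |β n m|) :
    IsSymmetricOperator T ∧ HasDeficiencyIndices T ⊤ ⊤ ∧ ¬ IsEssentiallySelfAdjoint T := by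
  refine ⟨h.isSymmetricOperator, ⟨fun z hz => ?_, fun z hz => ?_⟩, ?_⟩
  · exact h.deficiencyDim_eq_top fun n =>
      deficiencySubspace_jacobiOperator_ne_bot (hc n) hz.ne'
  · exact h.deficiencyDim_eq_top fun n =>
      deficiencySubspace_jacobiOperator_ne_bot (hc n) hz.ne
  · have hI : Complex.I.im ≠ 0 := by simp
    exact h.not_isEssentiallySelfAdjoint hI 0
      (deficiencySubspace_jacobiOperator_ne_bot (hc 0) hI)

end Recurrence


/-! ### Ladder relations and orthonormality of the Hermite-Gaussian modes -/

section HermiteFunctions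

open Polynomial in
theorem derivative_hermite_succ (m : ℕ) :
    derivative (hermite (m + 1)) = ((m : ℤ[X]) + 1) * hermite m := by
  induction m with
  | zero => simp
  | succ m ih =>
    rw [hermite_succ (m + 1), derivative_sub, derivative_mul, ih, derivative_X, hermite_succ m,
      derivative_mul]
    simp
    ring

/-- The normalized Hermite function of one variable, up to the factor `π ^ (-1/4)`. -/
def hermiteFunction (m : ℕ) (t : ℝ) : ℝ :=
  1 / √(m.factorial) * Polynomial.aeval (√2 * t) (Polynomial.hermite m) * Real.exp (-t ^ 2 / 2)

theorem inv_sqrt_factorial_succ (m : ℕ) :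
    √((m : ℝ) + 1) * (1 / √((m + 1).factorial : ℝ)) = 1 / √(m.factorial : ℝ) := by
  have h1 : √((m : ℝ) + 1) ≠ 0 := by positivity
  rw [Nat.factorial_succ, Nat.cast_mul, Real.sqrt_mul (by positivity)]
  push_cast
  field_simp

/-- This is the raising relation, solved for the derivative. It comes from `He_{m+1} = X He_m -
He_m'`. -/
theorem hasDerivAt_hermiteFunction (m : ℕ) (t : ℝ) :
    HasDerivAt (hermiteFunction m)
      (t * hermiteFunction m t - √2 * √((m : ℝ) + 1) * hermiteFunction (m + 1) t) t := by
  have h1 : HasDerivAt (fun t : ℝ => Polynomial.aeval (√2 * t) (Polynomial.hermite m))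
      (Polynomial.aeval (√2 * t) (Polynomial.derivative (Polynomial.hermite m)) * √2) t :=
    (Polynomial.hasDerivAt_aeval (Polynomial.hermite m) (√2 * t)).comp t
      (by simpa using (hasDerivAt_id t).const_mul (√2))
  have h2 : HasDerivAt (fun t : ℝ => Real.exp (-t ^ 2 / 2)) (Real.exp (-t ^ 2 / 2) * -t) t := by
    have : HasDerivAt (fun t : ℝ => -t ^ 2 / 2) (-t) t := by
      refine ((hasDerivAt_pow 2 t).neg.div_const 2).congr_deriv ?_
      norm_num
      ring
    exact this.exp
  refine HasDerivAt.congr_deriv (f := hermiteFunction m)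
    ((h1.const_mul (1 / √(m.factorial : ℝ))).mul h2) ?_
  have h3 := inv_sqrt_factorial_succ m
  have h4 : √2 * √2 = (2 : ℝ) := Real.mul_self_sqrt (by norm_num)
  simp only [hermiteFunction, Polynomial.hermite_succ, map_sub, map_mul, Polynomial.aeval_X]
  rw [← h3]
  linear_combination (√((m : ℝ) + 1) * (1 / √((m + 1).factorial : ℝ)) * t *
    Polynomial.aeval (√2 * t) (Polynomial.hermite m) * Real.exp (-t ^ 2 / 2)) * h4

theorem sqrt_two_mul_hermiteFunction_zero (t : ℝ) :
    √2 * t * hermiteFunction 0 t = hermiteFunction 1 t := by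
  simp [hermiteFunction]

theorem sqrt_two_mul_hermiteFunction_succ (m : ℕ) (t : ℝ) :
    √2 * t * hermiteFunction (m + 1) t =
      √((m : ℝ) + 2) * hermiteFunction (m + 2) t + √((m : ℝ) + 1) * hermiteFunction m t := by
  have h1 := inv_sqrt_factorial_succ (m + 1)
  have h2 := inv_sqrt_factorial_succ m
  have h3 : √((m : ℝ) + 1) * √((m : ℝ) + 1) = (m : ℝ) + 1 := Real.mul_self_sqrt (by positivity)
  rw [show ((m + 1 : ℕ) : ℝ) + 1 = (m : ℝ) + 2 by push_cast; ring] at h1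
  simp only [hermiteFunction, Polynomial.hermite_succ (m + 1), derivative_hermite_succ, map_sub,
    map_mul, Polynomial.aeval_X, map_add, map_natCast, map_one]
  rw [← h2, ← h1]
  linear_combination (√((m : ℝ) + 2) * (1 / √((m + 2).factorial : ℝ)) *
    Polynomial.aeval (√2 * t) (Polynomial.hermite m) * Real.exp (-t ^ 2 / 2)) * (-h3)

theorem mode_eq_hermiteFunction (m n : ℕ) (p : Plane) :
    mode m n p =
      ((1 / √Real.pi * hermiteFunction m (p 0) * hermiteFunction n (p 1) : ℝ) : ℂ) := by
  rw [mode_apply]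
  congr 1
  have h : Real.exp (-(p 0 ^ 2 + p 1 ^ 2) / 2) =
      Real.exp (-p 0 ^ 2 / 2) * Real.exp (-p 1 ^ 2 / 2) := by
    rw [← Real.exp_add]
    congr 1
    ring
  rw [h, Real.sqrt_mul (by positivity), Real.sqrt_mul (by positivity)]
  simp only [hermiteFunction]
  field_simp

theorem partialDeriv_zero_mode (m n : ℕ) :
    partialDeriv 0 (mode m n) = position 0 (mode m n) -
      ((√2 * √((m : ℝ) + 1) : ℝ) : ℂ) • mode (m + 1) n := by
  ext p
  rw [partialDeriv_apply, sub_apply, smul_apply, position_apply]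
  refine HasLineDerivAt.lineDeriv ?_
  rw [HasLineDerivAt]
  simp only [mode_eq_hermiteFunction, PiLp.add_apply, PiLp.smul_apply, PiLp.single_apply,
    smul_eq_mul, if_true, mul_one, one_ne_zero, if_false, mul_zero, add_zero]
  have h : HasDerivAt (fun t : ℝ => hermiteFunction m (p 0 + t)) _ 0 :=
    HasDerivAt.comp_const_add (p 0) 0 (hasDerivAt_hermiteFunction m (p 0 + 0))
  refine ((h.const_mul (1 / √Real.pi)).mul_const (hermiteFunction n (p 1))).ofReal_comp.congr_deriv
    ?_
  rw [add_zero]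
  push_cast
  ring

theorem partialDeriv_one_mode (m n : ℕ) :
    partialDeriv 1 (mode m n) = position 1 (mode m n) -
      ((√2 * √((n : ℝ) + 1) : ℝ) : ℂ) • mode m (n + 1) := by
  ext p
  rw [partialDeriv_apply, sub_apply, smul_apply, position_apply]
  refine HasLineDerivAt.lineDeriv ?_
  rw [HasLineDerivAt]
  simp only [mode_eq_hermiteFunction, PiLp.add_apply, PiLp.smul_apply, PiLp.single_apply,
    smul_eq_mul, if_true, mul_one, zero_ne_one, if_false, mul_zero, add_zero]
  have h : HasDerivAt (fun t : ℝ => hermiteFunction n (p 1 + t)) _ 0 :=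
    HasDerivAt.comp_const_add (p 1) 0 (hasDerivAt_hermiteFunction n (p 1 + 0))
  refine (h.const_mul (1 / √Real.pi * hermiteFunction m (p 0))).ofReal_comp.congr_deriv ?_
  rw [add_zero]
  push_cast
  ring

theorem inv_sqrt_two_mul_sqrt_two : ((1 / √2 : ℝ) : ℂ) * ((√2 : ℝ) : ℂ) = 1 := by
  rw [← Complex.ofReal_mul, one_div_mul_cancel (by positivity), Complex.ofReal_one]

/-- Lowering thereby follows from raising and the three-term recurrence, with no further
differentiation. -/
theorem an_eq (i : Fin 2) (f : 𝓢(Plane, ℂ)) :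
    an i f = ((√2 : ℝ) : ℂ) • position i f - cr i f := by
  have h : ((√2 : ℝ) : ℂ) = ((1 / √2 : ℝ) : ℂ) * 2 := by
    have h2 : ((√2 : ℝ) : ℂ) * ((√2 : ℝ) : ℂ) = 2 := by
      rw [← Complex.ofReal_mul, Real.mul_self_sqrt (by norm_num)]; simp
    rw [← h2, ← mul_assoc, inv_sqrt_two_mul_sqrt_two, one_mul]
  simp only [an, cr, LinearMap.smul_apply, LinearMap.add_apply, LinearMap.sub_apply, h]
  module

/-- A sequence of vectors on which the operators `A` and `B` act as the creation and annihilation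
operators of a harmonic oscillator. -/
structure IsLadder {V : Type*} [AddCommGroup V] [Module ℂ V] (A B : Module.End ℂ V)
    (ψ : ℕ → V) : Prop where
  raise : ∀ m, A (ψ m) = ((√((m : ℝ) + 1) : ℝ) : ℂ) • ψ (m + 1)
  lower_zero : B (ψ 0) = 0
  lower_succ : ∀ m, B (ψ (m + 1)) = ((√((m : ℝ) + 1) : ℝ) : ℂ) • ψ m

theorem isLadder_mode_zero (n : ℕ) : IsLadder (cr 0) (an 0) fun m => mode m n := by
  have hcr : ∀ m, cr 0 (mode m n) = ((√((m : ℝ) + 1) : ℝ) : ℂ) • mode (m + 1) n := by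
    intro m
    rw [cr, LinearMap.smul_apply, LinearMap.sub_apply, partialDeriv_zero_mode, sub_sub_cancel,
      smul_smul, Complex.ofReal_mul, ← mul_assoc, inv_sqrt_two_mul_sqrt_two, one_mul]
  refine ⟨hcr, ?_, fun m => ?_⟩
  · rw [an_eq, hcr]
    ext p
    simp only [sub_apply, smul_apply, position_apply,
      mode_eq_hermiteFunction, smul_eq_mul, zero_add, ← sqrt_two_mul_hermiteFunction_zero (p 0),
      zero_apply]
    simp
    ring
  · rw [an_eq, hcr]
    ext p
    have h := sqrt_two_mul_hermiteFunction_succ m (p 0)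
    simp only [sub_apply, smul_apply, position_apply,
      mode_eq_hermiteFunction, smul_eq_mul, ← Complex.ofReal_mul, ← Complex.ofReal_sub]
    congr 1
    rw [show ((m + 1 : ℕ) : ℝ) + 1 = (m : ℝ) + 2 by push_cast; ring]
    linear_combination (1 / √Real.pi * hermiteFunction n (p 1)) * h

theorem isLadder_mode_one (n : ℕ) : IsLadder (cr 1) (an 1) fun m => mode n m := by
  have hcr : ∀ m, cr 1 (mode n m) = ((√((m : ℝ) + 1) : ℝ) : ℂ) • mode n (m + 1) := by
    intro m
    rw [cr, LinearMap.smul_apply, LinearMap.sub_apply, partialDeriv_one_mode, sub_sub_cancel,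
      smul_smul, Complex.ofReal_mul, ← mul_assoc, inv_sqrt_two_mul_sqrt_two, one_mul]
  refine ⟨hcr, ?_, fun m => ?_⟩
  · rw [an_eq, hcr]
    ext p
    simp only [sub_apply, smul_apply, position_apply,
      mode_eq_hermiteFunction, smul_eq_mul, zero_add, ← sqrt_two_mul_hermiteFunction_zero (p 1),
      zero_apply]
    simp
    ring
  · rw [an_eq, hcr]
    ext p
    have h := sqrt_two_mul_hermiteFunction_succ m (p 1)
    simp only [sub_apply, smul_apply, position_apply,
      mode_eq_hermiteFunction, smul_eq_mul, ← Complex.ofReal_mul, ← Complex.ofReal_sub]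
    congr 1
    rw [show ((m + 1 : ℕ) : ℝ) + 1 = (m : ℝ) + 2 by push_cast; ring]
    linear_combination (1 / √Real.pi * hermiteFunction n (p 0)) * h

section Ladder

variable {V : Type*} [AddCommGroup V] [Module ℂ V] {A B C D : Module.End ℂ V} {ψ : ℕ → V}

theorem ofReal_sqrt_mul_self (m : ℕ) :
    ((√((m : ℝ) + 1) : ℝ) : ℂ) * ((√((m : ℝ) + 1) : ℝ) : ℂ) = (m : ℂ) + 1 := by
  rw [← Complex.ofReal_mul, Real.mul_self_sqrt (by positivity)]
  simp

theorem IsLadder.number (h : IsLadder A B ψ) (m : ℕ) : A (B (ψ m)) = (m : ℂ) • ψ m := by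
  rcases m with _ | m
  · simp [h.lower_zero]
  · rw [h.lower_succ, map_smul, h.raise, smul_smul, ofReal_sqrt_mul_self]
    push_cast
    rfl

/-- The cubic expression of the fourth generator in abstract ladder operators. -/
def cubicReal (A B C D : Module.End ℂ V) : Module.End ℂ V :=
  (1 / 2 : ℂ) • (A + B - A * A * B - A * B * B - A * C * D - B * C * D)

/-- The cubic expression of the fifth generator in abstract ladder operators. -/
def cubicImag (A B C D : Module.End ℂ V) : Module.End ℂ V :=
  (-(Complex.I / 2)) • (A - B - A * A * B + A * B * B - A * C * D + B * C * D)

theorem IsLadder.cubicReal_apply (h : IsLadder A B ψ) {n : ℕ}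
    (hn : ∀ m, C (D (ψ m)) = (n : ℂ) • ψ m) (m : ℕ) :
    cubicReal A B C D (ψ m) = jacobiImage (fun m => (β n m : ℂ)) ψ m := by
  rcases m with _ | m
  · simp only [cubicReal, LinearMap.smul_apply, LinearMap.add_apply, LinearMap.sub_apply,
      Module.End.mul_apply, hn, map_smul, h.raise, h.lower_zero, jacobiImage, β,
      smul_smul, map_zero]
    push_cast
    module
  -- The number operator is applied at `m + 1` before any lowering rule can expand `B (ψ (m + 1))`.
  -- In `A * B * B` a single lowering then leaves `A (B (ψ m))`, so no case split on `m` is needed.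
  · simp only [cubicReal, LinearMap.smul_apply, LinearMap.add_apply, LinearMap.sub_apply,
      Module.End.mul_apply, hn, h.number (m + 1)]
    simp only [h.number, map_smul, h.raise, h.lower_succ, jacobiImage, β,
      smul_smul, Complex.conj_ofReal]
    push_cast
    module

theorem IsLadder.cubicImag_apply (h : IsLadder A B ψ) {n : ℕ}
    (hn : ∀ m, C (D (ψ m)) = (n : ℂ) • ψ m) (m : ℕ) :
    cubicImag A B C D (ψ m) = jacobiImage (fun m => -Complex.I * (β n m : ℂ)) ψ m := by
  rcases m with _ | m
  · simp only [cubicImag, LinearMap.smul_apply, LinearMap.add_apply, LinearMap.sub_apply,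
      Module.End.mul_apply, hn, map_smul, h.raise, h.lower_zero, jacobiImage, β,
      smul_smul, map_zero]
    push_cast
    module
  · simp only [cubicImag, LinearMap.smul_apply, LinearMap.add_apply, LinearMap.sub_apply,
      Module.End.mul_apply, hn, h.number (m + 1)]
    simp only [h.number, map_smul, h.raise, h.lower_succ, jacobiImage, β,
      smul_smul, map_mul, map_neg, Complex.conj_I, Complex.conj_ofReal]
    push_cast
    module

/-- Moving `A` across as `B` lowers both indices together until one reaches the annihilated ground
vector. Two different ladders are allowed because modes of different orders in `y` form different
ladders in `x`. -/
theorem IsLadder.inner_eq {H : Type*} [NormedAddCommGroup H] [InnerProductSpace ℂ H]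
    (ι : V → H) (hι : ∀ (a : ℂ) v, ι (a • v) = a • ι v)
    (hAB : ∀ f g, inner ℂ (ι (A f)) (ι g) = inner ℂ (ι f) (ι (B g))) {χ : ℕ → V}
    (hψ : IsLadder A B ψ) (hχ : IsLadder A B χ) (m n : ℕ) :
    inner ℂ (ι (ψ m)) (ι (χ n)) = if m = n then inner ℂ (ι (ψ 0)) (ι (χ 0)) else (0 : ℂ) := by
  have hne : ∀ m : ℕ, ((√((m : ℝ) + 1) : ℝ) : ℂ) ≠ 0 := fun m => by
    rw [Complex.ofReal_ne_zero]; positivity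
  have hι0 : ι 0 = 0 := by simpa using hι 0 0
  induction m generalizing n with
  | zero =>
    rcases n with _ | n
    · simp
    · rw [if_neg (by omega)]
      have h := hAB (χ n) (ψ 0)
      rw [hψ.lower_zero, hι0, inner_zero_right, hχ.raise, hι, inner_smul_left] at h
      exact inner_eq_zero_symm.mp
        ((mul_eq_zero.mp h).resolve_left ((map_ne_zero (starRingEnd ℂ)).mpr (hne n)))
  | succ m ih =>
    have h := hAB (ψ m) (χ n)
    rw [hψ.raise, hι, inner_smul_left, Complex.conj_ofReal] at h
    refine mul_left_cancel₀ (hne m) (h.trans ?_)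
    rcases n with _ | n
    · rw [hχ.lower_zero, hι0, inner_zero_right, if_neg (by omega), mul_zero]
    · rw [hχ.lower_succ, hι, inner_smul_right, ih n]
      by_cases hmn : m = n
      · subst hmn; simp
      · simp [hmn]

end Ladder

theorem inner_toLTwo (f g : 𝓢(Plane, ℂ)) :
    inner ℂ (toLTwo f) (toLTwo g) = ∫ p, conj (f p) * g p := by
  have h := SchwartzMap.inner_toL2_toL2_eq f g (volume : Measure Plane)
  simp only [RCLike.inner_apply'] at h
  exact h

theorem inner_toLTwo_position (i : Fin 2) (f g : 𝓢(Plane, ℂ)) :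
    inner ℂ (toLTwo (position i f)) (toLTwo g) = inner ℂ (toLTwo f) (toLTwo (position i g)) := by
  rw [inner_toLTwo, inner_toLTwo]
  congr 1
  funext p
  rw [position_apply, position_apply, map_mul, Complex.conj_ofReal]
  ring

theorem inner_toLTwo_partialDeriv (i : Fin 2) (f g : 𝓢(Plane, ℂ)) :
    inner ℂ (toLTwo (partialDeriv i f)) (toLTwo g) =
      -inner ℂ (toLTwo f) (toLTwo (partialDeriv i g)) := by
  rw [inner_toLTwo, inner_toLTwo]
  have h := SchwartzMap.integral_bilinear_lineDerivOp_right_eq_neg_left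
    (μ := (volume : Measure Plane)) f g
    ((ContinuousLinearMap.mul ℝ ℂ).comp (Complex.conjCLE : ℂ →L[ℝ] ℂ))
    (EuclideanSpace.single i (1 : ℝ))
  exact neg_eq_iff_eq_neg.mp h.symm

theorem inner_toLTwo_cr (i : Fin 2) (f g : 𝓢(Plane, ℂ)) :
    inner ℂ (toLTwo (cr i f)) (toLTwo g) = inner ℂ (toLTwo f) (toLTwo (an i g)) := by
  simp only [cr, an, LinearMap.smul_apply, LinearMap.sub_apply, LinearMap.add_apply, map_smul,
    map_sub, map_add, inner_smul_left, inner_smul_right, inner_sub_left, inner_add_right,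
    inner_toLTwo_position, inner_toLTwo_partialDeriv, Complex.conj_ofReal, sub_neg_eq_add]

theorem inner_mode_zero_zero :
    inner ℂ (toLTwo (mode 0 0)) (toLTwo (mode 0 0)) = (1 : ℂ) := by
  have h : ∀ p : Plane, conj (mode 0 0 p) * mode 0 0 p =
      ((1 / Real.pi * Real.exp (-1 * ‖p‖ ^ 2) : ℝ) : ℂ) := by
    intro p
    rw [mode_apply, Complex.conj_ofReal, ← Complex.ofReal_mul]
    congr 1
    have he : Real.exp (-1 * ‖p‖ ^ 2) = Real.exp (-(p 0 ^ 2 + p 1 ^ 2) / 2) ^ 2 := by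
      rw [← Real.exp_nat_mul, EuclideanSpace.real_norm_sq_eq]
      congr 1
      simp [Fin.sum_univ_two]
      ring
    have hpi : √Real.pi ^ 2 = Real.pi := Real.sq_sqrt Real.pi_pos.le
    rw [he]
    nth_rw 3 [← hpi]
    simp
    ring
  rw [inner_toLTwo]
  simp only [h]
  rw [integral_complex_ofReal, integral_const_mul,
    GaussianFourier.integral_rexp_neg_mul_sq_norm one_pos]
  simp [Real.pi_ne_zero]

theorem orthonormal_mode : Orthonormal ℂ fun k : ℕ × ℕ => toLTwo (mode k.1 k.2) := by
  rw [orthonormal_iff_ite]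
  rintro ⟨m, n⟩ ⟨m', n'⟩
  -- Descending in `x` reduces both orders to `0`; descending in `y` then leaves only the norm of
  -- the ground state.
  rw [IsLadder.inner_eq toLTwo (map_smul toLTwo) (inner_toLTwo_cr 0) (isLadder_mode_zero n)
      (isLadder_mode_zero n') m m',
    IsLadder.inner_eq toLTwo (map_smul toLTwo) (inner_toLTwo_cr 1) (isLadder_mode_one 0)
      (isLadder_mode_one 0) n n', inner_mode_zero_zero]
  simp only [Prod.mk.injEq]
  split_ifs <;> simp_all

end HermiteFunctions


/-! ### Totality of the modes, and the sectors of the four generators -/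

section Density

theorem mode_mem_modeSpan (m n : ℕ) : mode m n ∈ modeSpan :=
  Submodule.subset_span ⟨(m, n), rfl⟩

theorem modeSpan_le_comap {A : Module.End ℂ 𝓢(Plane, ℂ)}
    (h : ∀ m n, A (mode m n) ∈ modeSpan) : modeSpan ≤ modeSpan.comap A := by
  rw [modeSpan, Submodule.span_le]
  rintro _ ⟨k, rfl⟩
  exact h k.1 k.2

theorem IsLadder.apply_mem {V : Type*} [AddCommGroup V] [Module ℂ V] {A B : Module.End ℂ V}
    {ψ : ℕ → V} (h : IsLadder A B ψ) {D : Submodule ℂ V} (hD : ∀ m, ψ m ∈ D) (m : ℕ) :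
    A (ψ m) ∈ D ∧ B (ψ m) ∈ D := by
  refine ⟨h.raise m ▸ D.smul_mem _ (hD _), ?_⟩
  rcases m with _ | m
  · exact h.lower_zero ▸ D.zero_mem
  · exact h.lower_succ m ▸ D.smul_mem _ (hD _)

theorem cr_mode_mem (i : Fin 2) (m n : ℕ) :
    cr i (mode m n) ∈ modeSpan ∧ an i (mode m n) ∈ modeSpan := by
  fin_cases i
  · exact (isLadder_mode_zero n).apply_mem (fun m => mode_mem_modeSpan m n) m
  · exact (isLadder_mode_one m).apply_mem (mode_mem_modeSpan m) n

theorem position_eq (i : Fin 2) (f : 𝓢(Plane, ℂ)) :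
    position i f = ((1 / √2 : ℝ) : ℂ) • (cr i f + an i f) := by
  rw [an_eq, add_sub_cancel, smul_smul, inv_sqrt_two_mul_sqrt_two, one_smul]

theorem position_mem_modeSpan (i : Fin 2) {f : 𝓢(Plane, ℂ)} (hf : f ∈ modeSpan) :
    position i f ∈ modeSpan := by
  refine modeSpan_le_comap (A := position i) (fun m n => ?_) hf
  rw [position_eq]
  exact modeSpan.smul_mem _ (modeSpan.add_mem (cr_mode_mem i m n).1 (cr_mode_mem i m n).2)

theorem gaussian_apply (p : Plane) : gaussian p = ((Real.exp (-(‖p‖ ^ 2 / 2)) : ℝ) : ℂ) := rfl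

theorem gaussian_eq_smul_mode : gaussian = ((√Real.pi : ℝ) : ℂ) • mode 0 0 := by
  ext p
  rw [smul_apply, mode_apply, gaussian_apply, EuclideanSpace.real_norm_sq_eq, smul_eq_mul,
    ← Complex.ofReal_mul]
  congr 1
  have : √Real.pi ≠ 0 := by positivity
  simp [Fin.sum_univ_two, this]
  ring_nf

/-- Multiplication by the linear form `p ↦ ⟪p, ξ⟫`. -/
def linearForm (ξ : Plane) : Module.End ℂ 𝓢(Plane, ℂ) :=
  ((ξ 0 : ℝ) : ℂ) • position 0 + ((ξ 1 : ℝ) : ℂ) • position 1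

theorem linearForm_pow_gaussian_mem (ξ : Plane) (k : ℕ) :
    (linearForm ξ ^ k) gaussian ∈ modeSpan := by
  induction k with
  | zero =>
    rw [pow_zero, Module.End.one_apply, gaussian_eq_smul_mode]
    exact modeSpan.smul_mem _ (mode_mem_modeSpan 0 0)
  | succ k ih =>
    rw [pow_succ', Module.End.mul_apply, linearForm]
    exact modeSpan.add_mem (modeSpan.smul_mem _ (position_mem_modeSpan 0 ih))
      (modeSpan.smul_mem _ (position_mem_modeSpan 1 ih))

theorem linearForm_pow_apply (ξ : Plane) (k : ℕ) (f : 𝓢(Plane, ℂ)) (p : Plane) :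
    (linearForm ξ ^ k) f p = ((inner ℝ p ξ : ℝ) : ℂ) ^ k * f p := by
  induction k with
  | zero => simp
  | succ k ih =>
    rw [pow_succ', Module.End.mul_apply, linearForm, LinearMap.add_apply, LinearMap.smul_apply,
      LinearMap.smul_apply, add_apply, smul_apply, smul_apply,
      position_apply, position_apply]
    change _ * (_ * (linearForm ξ ^ k) f p) + _ * (_ * (linearForm ξ ^ k) f p) = _
    rw [ih, PiLp.inner_apply]
    simp [Fin.sum_univ_two]
    ring

theorem memLp_exp_neg_mul_norm_sq {b : ℝ} (hb : 0 < b) :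
    MemLp (fun p : Plane => Real.exp (-b * ‖p‖ ^ 2)) 2 volume := by
  have hc : Continuous fun p : Plane => Real.exp (-b * ‖p‖ ^ 2) := by fun_prop
  rw [memLp_two_iff_integrable_sq hc.aestronglyMeasurable]
  have h := GaussianFourier.integrable_cexp_neg_mul_sq_norm_add (V := Plane) (b := (2 * b : ℝ))
    (by simpa using hb) 0 0
  refine h.norm.congr (Filter.Eventually.of_forall fun p => ?_)
  simp only [zero_mul, add_zero, Complex.norm_exp]
  rw [← Real.exp_nat_mul, ← Complex.ofReal_pow, ← Complex.ofReal_neg, ← Complex.ofReal_mul,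
    Complex.ofReal_re]
  congr 1
  push_cast
  ring

theorem exp_mul_exp_neg_le (r s : ℝ) :
    Real.exp (s * r) * Real.exp (-(r ^ 2 / 2)) ≤
      Real.exp (s ^ 2) * Real.exp (-(1 / 4) * r ^ 2) := by
  rw [← Real.exp_add, ← Real.exp_add]
  refine Real.exp_le_exp.mpr ?_
  nlinarith [sq_nonneg (r / 2 - s)]

/-- The Gaussian absorbs every exponential and remains square-integrable; this supplies the majorant
for summing the exponential series under the integral. -/
theorem integrable_exp_mul_gaussian (f : LTwo) (s : ℝ) :
    Integrable (fun p : Plane => Real.exp (s * ‖p‖) * ‖gaussian p * f p‖) volume := by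
  have hf : MemLp (fun p => ‖f p‖) 2 volume := (Lp.memLp f).norm
  have hint := ((memLp_exp_neg_mul_norm_sq (b := 1 / 4) (by norm_num)).integrable_mul hf).const_mul
    (Real.exp (s ^ 2))
  refine hint.mono ?_ (Filter.Eventually.of_forall fun p => ?_)
  · refine AEStronglyMeasurable.mul ?_ ?_
    · exact (by fun_prop : Continuous fun p : Plane => Real.exp (s * ‖p‖)).aestronglyMeasurable
    · exact (gaussian.continuous.aestronglyMeasurable.mul (Lp.aestronglyMeasurable f)).norm
  · rw [Real.norm_of_nonneg (by positivity), 
      Real.norm_of_nonneg (by simp only [Pi.mul_apply]; positivity)]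
    simp only [Pi.mul_apply]
    rw [norm_mul, gaussian_apply, Complex.norm_real, Real.norm_of_nonneg (Real.exp_pos _).le,
      ← mul_assoc, ← mul_assoc]
    exact mul_le_mul_of_nonneg_right (exp_mul_exp_neg_le ‖p‖ s) (norm_nonneg _)

theorem integrable_gaussian_mul (f : LTwo) :
    Integrable (fun p : Plane => gaussian p * f p) volume := by
  have h := integrable_exp_mul_gaussian f 0
  simp only [zero_mul, Real.exp_zero, one_mul] at h
  exact (integrable_norm_iff
    (gaussian.continuous.aestronglyMeasurable.mul (Lp.aestronglyMeasurable f))).mp h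

/-- Each term of the exponential series is a power of a linear form times the Gaussian, which lies
in `modeSpan`, so its integral against `f` vanishes. Dominated convergence sums the series. -/
theorem integral_exp_mul_gaussian_eq_zero {f : LTwo}
    (hf : ∀ v ∈ modeSpan, inner ℂ (toLTwo v) f = 0) (ξ : Plane) (c : ℂ) :
    ∫ p : Plane, Complex.exp (c * ((inner ℝ p ξ : ℝ) : ℂ)) * (gaussian p * f p) = 0 := by
  have hterm : ∀ k : ℕ, ∫ p : Plane,
      ((c * ((inner ℝ p ξ : ℝ) : ℂ)) ^ k / (k.factorial : ℂ)) * (gaussian p * f p) = 0 := by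
    intro k
    have h := hf _ (linearForm_pow_gaussian_mem ξ k)
    rw [L2.inner_def] at h
    have h2 : ∫ p : Plane, ((inner ℝ p ξ : ℝ) : ℂ) ^ k * (gaussian p * f p) = 0 := by
      rw [← h]
      refine integral_congr_ae ?_
      filter_upwards [SchwartzMap.coeFn_toLp ((linearForm ξ ^ k) gaussian) 2 volume] with p hp
      change _ = inner ℂ (((linearForm ξ ^ k) gaussian).toLp 2 volume p) (f p)
      rw [hp, RCLike.inner_apply', linearForm_pow_apply, gaussian_apply]
      simp only [map_mul, map_pow, Complex.conj_ofReal]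
      ring
    have h3 := congrArg (fun w => c ^ k / (k.factorial : ℂ) * w) h2
    simp only [mul_zero] at h3
    rw [← integral_const_mul] at h3
    rw [← h3]
    congr 1
    funext p
    rw [mul_pow]
    ring
  have hexp : ∀ w : ℂ, HasSum (fun k : ℕ => w ^ k / (k.factorial : ℂ)) (Complex.exp w) := by
    intro w
    rw [Complex.exp_eq_exp_ℂ]
    exact NormedSpace.expSeries_div_hasSum_exp w
  have hrexp : ∀ x : ℝ, HasSum (fun k : ℕ => x ^ k / (k.factorial : ℝ)) (Real.exp x) := by
    intro x
    rw [Real.exp_eq_exp_ℝ]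
    exact NormedSpace.expSeries_div_hasSum_exp x
  have hmeas : AEStronglyMeasurable (fun p : Plane => gaussian p * f p) volume :=
    (integrable_gaussian_mul f).aestronglyMeasurable
  have hb : ∀ p : Plane, HasSum (fun k : ℕ => ((‖c‖ * ‖ξ‖ * ‖p‖) ^ k / (k.factorial : ℝ)) *
      ‖gaussian p * f p‖) (Real.exp (‖c‖ * ‖ξ‖ * ‖p‖) * ‖gaussian p * f p‖) :=
    fun p => (hrexp _).mul_right _
  have hs := hasSum_integral_of_dominated_convergence (μ := (volume : Measure Plane))
    (F := fun (k : ℕ) (p : Plane) =>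
      ((c * ((inner ℝ p ξ : ℝ) : ℂ)) ^ k / (k.factorial : ℂ)) * (gaussian p * f p))
    (f := fun p => Complex.exp (c * ((inner ℝ p ξ : ℝ) : ℂ)) * (gaussian p * f p))
    (fun k p => ((‖c‖ * ‖ξ‖ * ‖p‖) ^ k / (k.factorial : ℝ)) * ‖gaussian p * f p‖)
    (fun k => (by fun_prop : Continuous fun p : Plane =>
      (c * ((inner ℝ p ξ : ℝ) : ℂ)) ^ k / (k.factorial : ℂ)).aestronglyMeasurable.mul hmeas)
    (fun k => Filter.Eventually.of_forall fun p => ?_)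
    (Filter.Eventually.of_forall fun p => (hb p).summable) ?_
    (Filter.Eventually.of_forall fun p => (hexp _).mul_right _)
  · simp only [hterm] at hs
    exact hs.unique hasSum_zero
  · rw [norm_mul, norm_div, norm_pow, norm_mul, Complex.norm_real, Complex.norm_natCast]
    have h : ‖c‖ * ‖(inner ℝ p ξ : ℝ)‖ ≤ ‖c‖ * ‖ξ‖ * ‖p‖ := by
      rw [mul_assoc, mul_comm ‖ξ‖]
      exact mul_le_mul_of_nonneg_left (norm_inner_le_norm p ξ) (norm_nonneg c)
    gcongr
  · simp only [(hb _).tsum_eq]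
    exact integrable_exp_mul_gaussian f _

open scoped FourierTransform in
-- A test function is the Fourier transform of the Schwartz function `𝓕⁻ φ`. Shifting the transform
-- onto `h` shows that `h` integrates to zero against every test function.
theorem ae_eq_zero_of_fourier_eq_zero {h : Plane → ℂ} (hi : Integrable h volume)
    (hF : ∀ ξ, 𝓕 h ξ = 0) : ∀ᵐ p ∂(volume : Measure Plane), h p = 0 := by
  refine ae_eq_zero_of_integral_contDiff_smul_eq_zero hi.locallyIntegrable fun g hg hgc => ?_
  have hgc' : HasCompactSupport fun p => ((g p : ℝ) : ℂ) := hgc.comp_left Complex.ofReal_zero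
  let φ : 𝓢(Plane, ℂ) := hgc'.toSchwartzMap (Complex.ofRealCLM.contDiff.comp hg)
  have hφ : ∀ p, φ p = ((g p : ℝ) : ℂ) := fun p => rfl
  have key := VectorFourier.integral_fourierIntegral_smul_eq_flip (L := innerₗ Plane)
    (μ := volume) (ν := volume)
    Real.continuous_fourierChar continuous_inner (𝓕⁻ φ).integrable hi
  have h1 : ∀ ξ, VectorFourier.fourierIntegral Real.fourierChar volume (innerₗ Plane)
      (𝓕⁻ φ : 𝓢(Plane, ℂ)) ξ = φ ξ := by
    intro ξ
    have : (𝓕 (𝓕⁻ φ) : 𝓢(Plane, ℂ)) = φ := FourierTransform.fourier_fourierInv_eq φ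
    conv_rhs => rw [← this]
    rfl
  have h2 : ∀ x, VectorFourier.fourierIntegral Real.fourierChar volume (innerₗ Plane).flip h x
      = 0 := by
    intro x
    rw [flip_innerₗ]
    exact hF x
  simp only [h1, h2, hφ, smul_zero, integral_zero] at key
  simpa using key

theorem eq_zero_of_forall_inner_modeSpan_eq_zero {f : LTwo}
    (hf : ∀ v ∈ modeSpan, inner ℂ (toLTwo v) f = 0) : f = 0 := by
  have h := ae_eq_zero_of_fourier_eq_zero (integrable_gaussian_mul f) fun ξ => by
    rw [Real.fourier_eq']
    simp only [smul_eq_mul]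
    rw [← integral_exp_mul_gaussian_eq_zero hf ξ (-2 * Real.pi * Complex.I)]
    congr 1
    funext p
    congr 2
    push_cast
    ring
  rw [Lp.eq_zero_iff_ae_eq_zero]
  filter_upwards [h] with p hp
  refine (mul_eq_zero.mp hp).resolve_left ?_
  rw [gaussian_apply, ← Ne, Complex.ofReal_ne_zero]
  exact (Real.exp_pos _).ne'

theorem onModes_domain_eq_map (A : Module.End ℂ 𝓢(Plane, ℂ)) :
    (onModes A).domain = modeSpan.map toLTwo := rfl

theorem dense_onModes_domain (A : Module.End ℂ 𝓢(Plane, ℂ)) :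
    Dense ((onModes A).domain : Set LTwo) := by
  rw [Submodule.dense_iff_topologicalClosure_eq_top, Submodule.topologicalClosure_eq_top_iff,
    Submodule.eq_bot_iff]
  intro f hf
  exact eq_zero_of_forall_inner_modeSpan_eq_zero fun v hv =>
    (Submodule.mem_orthogonal _ _).mp hf _ (Submodule.mem_map_of_mem hv)

theorem onModes_domain (A : Module.End ℂ 𝓢(Plane, ℂ)) :
    (onModes A).domain =
      Submodule.span ℂ (Set.range fun k : ℕ × ℕ => toLTwo (mode k.1 k.2)) := by
  rw [onModes_domain_eq_map, modeSpan, Submodule.map_span, ← Set.range_comp]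
  rfl

theorem hasJacobiSectors_onModes {A : Module.End ℂ 𝓢(Plane, ℂ)} {c : ℕ → ℕ → ℂ}
    (h : ∀ n m, A (mode m n) = jacobiImage (c n) (fun m => mode m n) m) :
    HasJacobiSectors (onModes A) (fun n m => toLTwo (mode m n)) c where
  orthonormal := orthonormal_mode.comp Prod.swap Prod.swap_injective
  dense := dense_onModes_domain A
  domain_eq := by
    rw [onModes_domain, ← Prod.swap_surjective.range_comp]
    rfl
  graph_mem n m := (realize_graph_iff _ _ _ _ _ _).mpr
    ⟨mode m n, mode_mem_modeSpan m n, rfl, by rw [h, map_jacobiImage]⟩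

theorem hasJacobiSectors_onModes_swap {A : Module.End ℂ 𝓢(Plane, ℂ)} {c : ℕ → ℕ → ℂ}
    (h : ∀ n m, A (mode n m) = jacobiImage (c n) (fun m => mode n m) m) :
    HasJacobiSectors (onModes A) (fun n m => toLTwo (mode n m)) c where
  orthonormal := orthonormal_mode
  dense := dense_onModes_domain A
  domain_eq := onModes_domain A
  graph_mem n m := (realize_graph_iff _ _ _ _ _ _).mpr
    ⟨mode n m, mode_mem_modeSpan n m, rfl, by rw [h, map_jacobiImage]⟩

theorem T4_hasJacobiSectors :
    HasJacobiSectors T4 (fun n m => toLTwo (mode m n)) fun n m => (β n m : ℂ) :=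
  hasJacobiSectors_onModes fun n m => (isLadder_mode_zero n).cubicReal_apply
    (C := cr 1) (D := an 1) (fun m => (isLadder_mode_one m).number n) m

theorem T5_hasJacobiSectors :
    HasJacobiSectors T5 (fun n m => toLTwo (mode m n)) fun n m => -Complex.I * (β n m : ℂ) :=
  hasJacobiSectors_onModes fun n m => (isLadder_mode_zero n).cubicImag_apply
    (C := cr 1) (D := an 1) (fun m => (isLadder_mode_one m).number n) m

theorem T6_hasJacobiSectors :
    HasJacobiSectors T6 (fun n m => toLTwo (mode n m)) fun n m => (β n m : ℂ) :=
  hasJacobiSectors_onModes_swap fun n m => (isLadder_mode_one n).cubicReal_apply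
    (C := cr 0) (D := an 0) (fun m => (isLadder_mode_zero m).number n) m

theorem T7_hasJacobiSectors :
    HasJacobiSectors T7 (fun n m => toLTwo (mode n m)) fun n m => -Complex.I * (β n m : ℂ) :=
  hasJacobiSectors_onModes_swap fun n m => (isLadder_mode_one n).cubicImag_apply
    (C := cr 0) (D := an 0) (fun m => (isLadder_mode_zero m).number n) m

end Density


/-! ### Conjugating the generators by unitaries of the Schwartz space -/

section Conjugation

theorem isConjugateBy_onModes (F : LTwo ≃ₗᵢ[ℂ] LTwo) (U : 𝓢(Plane, ℂ) ≃ₗ[ℂ] 𝓢(Plane, ℂ))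
    (hF : ∀ f, F (toLTwo f) = toLTwo (U f)) (hU : ∀ v ∈ modeSpan, U v ∈ modeSpan)
    (hU' : ∀ v ∈ modeSpan, U.symm v ∈ modeSpan) {A B : Module.End ℂ 𝓢(Plane, ℂ)}
    (hAB : ∀ f, U (A f) = B (U f)) : IsConjugateBy F (onModes A) (onModes B) := by
  intro f g
  rw [onModes, onModes, realize_graph_iff, realize_graph_iff]
  constructor
  · rintro ⟨v, hv, rfl, rfl⟩
    exact ⟨U v, hU v hv, (hF v).symm, by rw [← hAB, hF]⟩
  · rintro ⟨v, hv, hf, hg⟩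
    obtain ⟨w, rfl⟩ := U.surjective v
    rw [← hF] at hf
    rw [← hAB, ← hF] at hg
    exact ⟨w, by simpa using hU' _ hv, F.injective hf, F.injective hg⟩

section Cubic

variable {V : Type*} [AddCommGroup V] [Module ℂ V] {A B C D A' B' C' D' : Module.End ℂ V}

/-- Each monomial has one creation more than annihilations, or one fewer, so it acquires the factor
`-i` or `i`; these are the relative phases of the two expressions. -/
theorem map_cubicReal_eq_cubicImag (U : V ≃ₗ[ℂ] V)
    (hA : ∀ f, U (A f) = -Complex.I • A (U f)) (hB : ∀ f, U (B f) = Complex.I • B (U f))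
    (hC : ∀ f, U (C f) = -Complex.I • C (U f)) (hD : ∀ f, U (D f) = Complex.I • D (U f)) (f : V) :
    U (cubicReal A B C D f) = cubicImag A B C D (U f) := by
  simp only [cubicReal, cubicImag, LinearMap.smul_apply, LinearMap.add_apply, LinearMap.sub_apply,
    Module.End.mul_apply, map_smul, map_add, map_sub, hA, hB, hC, hD, smul_add, smul_sub, smul_smul]
  match_scalars <;> ring_nf <;> simp [Complex.I_pow_three] <;> ring

theorem map_cubicReal (U : V ≃ₗ[ℂ] V) (hA : ∀ f, U (A f) = A' (U f))
    (hB : ∀ f, U (B f) = B' (U f)) (hC : ∀ f, U (C f) = C' (U f))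
    (hD : ∀ f, U (D f) = D' (U f)) (f : V) :
    U (cubicReal A B C D f) = cubicReal A' B' C' D' (U f) := by
  simp [cubicReal, hA, hB, hC, hD]

theorem map_cubicImag (U : V ≃ₗ[ℂ] V) (hA : ∀ f, U (A f) = A' (U f))
    (hB : ∀ f, U (B f) = B' (U f)) (hC : ∀ f, U (C f) = C' (U f))
    (hD : ∀ f, U (D f) = D' (U f)) (f : V) :
    U (cubicImag A B C D f) = cubicImag A' B' C' D' (U f) := by
  simp [cubicImag, hA, hB, hC, hD]

theorem IsLadder.map_eq_smul {ψ : ℕ → V} (h : IsLadder A B ψ) (U : V ≃ₗ[ℂ] V) {c w : ℂ}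
    (hU : ∀ f, U (A f) = c • A (U f)) (h0 : U (ψ 0) = w • ψ 0) (m : ℕ) :
    U (ψ m) = (c ^ m * w) • ψ m := by
  induction m with
  | zero => simpa using h0
  | succ m ih =>
    have hne : ((√((m : ℝ) + 1) : ℝ) : ℂ) ≠ 0 := by
      rw [Complex.ofReal_ne_zero]; positivity
    have h1 := hU (ψ m)
    rw [ih, h.raise, map_smul, map_smul, h.raise] at h1
    refine smul_right_injective V hne (h1.trans ?_)
    simp only [smul_smul]
    congr 1
    ring

end Cubic

end Conjugation

/-! ### The unitary Fourier transform -/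

section Fourier

open scoped FourierTransform

/-- The dilation `f ↦ (2π)⁻¹ f (· / (2π))` of the Schwartz space, which is unitary in `L²(ℝ²)`. -/
def dilation : 𝓢(Plane, ℂ) ≃ₗ[ℂ] 𝓢(Plane, ℂ) :=
  LinearEquiv.ofLinearMap
    (((2 * Real.pi : ℝ) : ℂ)⁻¹ • (SchwartzMap.compCLMOfContinuousLinearEquiv ℂ
      (ContinuousLinearEquiv.smulLeft
        (Units.mk0 (2 * Real.pi)⁻¹ (inv_ne_zero Real.two_pi_pos.ne')))).toLinearMap)
    (((2 * Real.pi : ℝ) : ℂ) • (SchwartzMap.compCLMOfContinuousLinearEquiv ℂ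
      (ContinuousLinearEquiv.smulLeft (Units.mk0 (2 * Real.pi) Real.two_pi_pos.ne'))).toLinearMap)
    (by
      ext f p
      have h : ((2 * Real.pi : ℝ) : ℂ) ≠ 0 := Complex.ofReal_ne_zero.mpr Real.two_pi_pos.ne'
      have h' : 2 * Real.pi ≠ 0 := Real.two_pi_pos.ne'
      change ((2 * Real.pi : ℝ) : ℂ)⁻¹ * (((2 * Real.pi : ℝ) : ℂ) *
        f ((2 * Real.pi) • (2 * Real.pi)⁻¹ • p)) = f p
      rw [inv_mul_cancel_left₀ h, smul_inv_smul₀ h'])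
    (by
      ext f p
      have h : ((2 * Real.pi : ℝ) : ℂ) ≠ 0 := Complex.ofReal_ne_zero.mpr Real.two_pi_pos.ne'
      have h' : 2 * Real.pi ≠ 0 := Real.two_pi_pos.ne'
      change ((2 * Real.pi : ℝ) : ℂ) * (((2 * Real.pi : ℝ) : ℂ)⁻¹ *
        f ((2 * Real.pi)⁻¹ • (2 * Real.pi) • p)) = f p
      rw [mul_inv_cancel_left₀ h, inv_smul_smul₀ h'])

theorem dilation_apply (f : 𝓢(Plane, ℂ)) (p : Plane) :
    dilation f p = ((2 * Real.pi : ℝ) : ℂ)⁻¹ * f ((2 * Real.pi)⁻¹ • p) := rfl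

/-- The unitary Fourier transform of the Schwartz space. -/
def schwartzFourier : 𝓢(Plane, ℂ) ≃ₗ[ℂ] 𝓢(Plane, ℂ) :=
  (FourierTransform.fourierEquiv ℂ 𝓢(Plane, ℂ)).trans dilation

theorem schwartzFourier_apply (f : 𝓢(Plane, ℂ)) (ξ : Plane) :
    schwartzFourier f ξ = ((2 * Real.pi : ℝ) : ℂ)⁻¹ * 𝓕 f ((2 * Real.pi)⁻¹ • ξ) := rfl

/-- The kernel of `𝓕` is `exp (-2πi x·ξ)`; the dilation removes the `2π` from the exponent. -/
theorem schwartzFourier_apply_eq_integral (f : 𝓢(Plane, ℂ)) (ξ : Plane) :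
    schwartzFourier f ξ = ((1 / (2 * Real.pi) : ℝ) : ℂ) *
      ∫ x : Plane, Complex.exp (-(Complex.I * ((inner ℝ x ξ : ℝ) : ℂ))) * f x := by
  rw [schwartzFourier_apply, SchwartzMap.fourier_coe, Real.fourier_eq']
  congr 1
  · push_cast
    rw [one_div]
  · congr 1
    funext x
    rw [smul_eq_mul, inner_smul_right]
    congr 2
    have h : (Real.pi : ℂ) ≠ 0 := Complex.ofReal_ne_zero.mpr Real.pi_ne_zero
    push_cast
    field_simp

/-- In dimension two the Jacobian `(2π) ^ 2` cancels the square of the prefactor. -/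
theorem norm_toLTwo_dilation (f : 𝓢(Plane, ℂ)) : ‖toLTwo (dilation f)‖ = ‖toLTwo f‖ := by
  have hpi : (0 : ℝ) < 2 * Real.pi := Real.two_pi_pos
  have h : inner ℂ (toLTwo (dilation f)) (toLTwo (dilation f)) =
      inner ℂ (toLTwo f) (toLTwo f) := by
    rw [inner_toLTwo, inner_toLTwo]
    have h1 := Measure.integral_comp_smul (volume : Measure Plane)
      (fun p => conj (f p) * f p) (2 * Real.pi)⁻¹
    have h2 : ∀ p, conj (dilation f p) * dilation f p = (((2 * Real.pi) ^ 2 : ℝ) : ℂ)⁻¹ *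
        (conj (f ((2 * Real.pi)⁻¹ • p)) * f ((2 * Real.pi)⁻¹ • p)) := by
      intro p
      rw [dilation_apply, map_mul, map_inv₀, Complex.conj_ofReal]
      push_cast
      ring
    simp only [h2]
    rw [integral_const_mul, h1, finrank_euclideanSpace_fin, inv_pow, inv_inv,
      abs_of_pos (by positivity), Complex.real_smul, inv_mul_cancel_left₀]
    exact Complex.ofReal_ne_zero.mpr (by positivity)
  rw [inner_self_eq_norm_sq_to_K, inner_self_eq_norm_sq_to_K] at h
  have h' : ‖toLTwo (dilation f)‖ ^ 2 = ‖toLTwo f‖ ^ 2 := by exact_mod_cast h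
  exact (sq_eq_sq₀ (norm_nonneg _) (norm_nonneg _)).mp h'

theorem norm_toLTwo_schwartzFourier (f : 𝓢(Plane, ℂ)) :
    ‖toLTwo (schwartzFourier f)‖ = ‖toLTwo f‖ :=
  (norm_toLTwo_dilation _).trans (SchwartzMap.norm_fourier_toL2_eq f)

theorem denseRange_toLTwo : DenseRange toLTwo :=
  SchwartzMap.denseRange_toLpCLM ENNReal.ofNat_ne_top

/-- The unitary Fourier transform of `L²(ℝ²)`. -/
def unitaryFourier : LTwo ≃ₗᵢ[ℂ] LTwo :=
  schwartzFourier.extendOfIsometry toLTwo toLTwo denseRange_toLTwo denseRange_toLTwo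
    norm_toLTwo_schwartzFourier

theorem unitaryFourier_toLTwo (f : 𝓢(Plane, ℂ)) :
    unitaryFourier (toLTwo f) = toLTwo (schwartzFourier f) :=
  LinearEquiv.extendOfIsometry_eq _ _ _ _ _ _ f

theorem isFourierTransform_unitaryFourier : IsFourierTransform unitaryFourier := by
  intro f
  rw [unitaryFourier_toLTwo]
  filter_upwards [SchwartzMap.coeFn_toLp (schwartzFourier f) 2 volume] with ξ hξ
  rw [← schwartzFourier_apply_eq_integral]
  exact hξ

theorem smulLeftCLM_inner_single (i : Fin 2) (f : 𝓢(Plane, ℂ)) :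
    SchwartzMap.smulLeftCLM ℂ (inner ℝ · (EuclideanSpace.single i (1 : ℝ))) f = position i f := by
  ext p
  have h : (fun p : Plane => inner ℝ p (EuclideanSpace.single i (1 : ℝ))).HasTemperateGrowth :=
    ((innerSL ℝ).flip (EuclideanSpace.single i (1 : ℝ))).hasTemperateGrowth
  rw [SchwartzMap.smulLeftCLM_apply_apply h, position_apply, EuclideanSpace.inner_single_right]
  simp

theorem schwartzFourier_partialDeriv (i : Fin 2) (f : 𝓢(Plane, ℂ)) :
    schwartzFourier (partialDeriv i f) = Complex.I • position i (schwartzFourier f) := by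
  have h : 𝓕 (partialDeriv i f) = (2 * Real.pi * Complex.I) • position i (𝓕 f) := by
    rw [← smulLeftCLM_inner_single]
    exact SchwartzMap.fourier_lineDerivOp_eq f (EuclideanSpace.single i (1 : ℝ))
  ext ξ
  have hpi : (Real.pi : ℂ) ≠ 0 := Complex.ofReal_ne_zero.mpr Real.pi_ne_zero
  rw [schwartzFourier_apply, h, smul_apply, smul_apply, position_apply, position_apply,
    schwartzFourier_apply, PiLp.smul_apply]
  simp only [smul_eq_mul]
  push_cast
  field_simp

theorem partialDeriv_dilation (i : Fin 2) (f : 𝓢(Plane, ℂ)) :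
    partialDeriv i (dilation f) = ((2 * Real.pi : ℝ) : ℂ)⁻¹ • dilation (partialDeriv i f) := by
  have h := SchwartzMap.lineDerivOp_compCLMOfContinuousLinearEquiv (𝕜 := ℂ)
    (EuclideanSpace.single i (1 : ℝ)) (ContinuousLinearEquiv.smulLeft
      (Units.mk0 (2 * Real.pi)⁻¹ (inv_ne_zero Real.two_pi_pos.ne'))) f
  have hs : ∂_{(2 * Real.pi)⁻¹ • EuclideanSpace.single i (1 : ℝ)} f =
      (2 * Real.pi)⁻¹ • partialDeriv i f :=
    LineDeriv.lineDerivOp_left_smul _ _ f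
  ext p
  have hp := congrArg (fun g : 𝓢(Plane, ℂ) => ((2 * Real.pi : ℝ) : ℂ)⁻¹ * g p) h
  have hl : partialDeriv i (dilation f) = ((2 * Real.pi : ℝ) : ℂ)⁻¹ •
      partialDeriv i (SchwartzMap.compCLMOfContinuousLinearEquiv ℂ (ContinuousLinearEquiv.smulLeft
        (Units.mk0 (2 * Real.pi)⁻¹ (inv_ne_zero Real.two_pi_pos.ne'))) f) :=
    map_smul (partialDeriv i) _ _
  rw [hl]
  refine hp.trans ?_
  have hr : (∂_{(2 * Real.pi)⁻¹ • EuclideanSpace.single i (1 : ℝ)} f) ((2 * Real.pi)⁻¹ • p) =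
      ((2 * Real.pi : ℝ) : ℂ)⁻¹ * partialDeriv i f ((2 * Real.pi)⁻¹ • p) := by
    rw [hs, smul_apply, Complex.real_smul, Complex.ofReal_inv]
  exact congrArg (fun w => ((2 * Real.pi : ℝ) : ℂ)⁻¹ * w) hr

theorem schwartzFourier_position (i : Fin 2) (f : 𝓢(Plane, ℂ)) :
    schwartzFourier (position i f) = Complex.I • partialDeriv i (schwartzFourier f) := by
  have h : partialDeriv i (𝓕 f) = -(2 * Real.pi * Complex.I) • 𝓕 (position i f) := by
    rw [← smulLeftCLM_inner_single, ← FourierTransform.fourier_smul]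
    exact SchwartzMap.lineDerivOp_fourier_eq f (EuclideanSpace.single i (1 : ℝ))
  have h3 : schwartzFourier f = dilation (𝓕 f) := rfl
  have h4 : schwartzFourier (position i f) = dilation (𝓕 (position i f)) := rfl
  have hpi : (Real.pi : ℂ) ≠ 0 := Complex.ofReal_ne_zero.mpr Real.pi_ne_zero
  rw [h3, partialDeriv_dilation, h, h4, map_smul, smul_smul, smul_smul]
  have hc : Complex.I * ((2 * Real.pi : ℝ) : ℂ)⁻¹ * -(2 * Real.pi * Complex.I) = 1 := by
    push_cast
    field_simp
    rw [Complex.I_sq, neg_neg]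
  rw [hc, one_smul]

theorem schwartzFourier_cr (i : Fin 2) (f : 𝓢(Plane, ℂ)) :
    schwartzFourier (cr i f) = -Complex.I • cr i (schwartzFourier f) := by
  simp only [cr, LinearMap.smul_apply, LinearMap.sub_apply, map_smul, map_sub,
    schwartzFourier_position, schwartzFourier_partialDeriv]
  module

theorem schwartzFourier_an (i : Fin 2) (f : 𝓢(Plane, ℂ)) :
    schwartzFourier (an i f) = Complex.I • an i (schwartzFourier f) := by
  simp only [an, LinearMap.smul_apply, LinearMap.add_apply, map_smul, map_add,
    schwartzFourier_position, schwartzFourier_partialDeriv]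
  module

theorem schwartzFourier_gaussian : schwartzFourier gaussian = gaussian := by
  ext ξ
  have h := fourier_gaussian_innerProductSpace (V := Plane) (b := 1 / 2) (by norm_num)
    ((2 * Real.pi)⁻¹ • ξ)
  have hg : (gaussian : Plane → ℂ) = fun v => Complex.exp (-(1 / 2) * (‖v‖ : ℂ) ^ 2) := by
    funext v
    rw [gaussian_apply]
    push_cast
    congr 1
    ring
  have hpi : (Real.pi : ℂ) ≠ 0 := Complex.ofReal_ne_zero.mpr Real.pi_ne_zero
  rw [schwartzFourier_apply, SchwartzMap.fourier_coe, hg, h, finrank_euclideanSpace_fin, norm_smul,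
    Real.norm_of_nonneg (by positivity)]
  simp only [Nat.cast_ofNat, div_self (two_ne_zero' ℂ), Complex.cpow_one]
  rw [← mul_assoc]
  have h1 : ((2 * Real.pi : ℝ) : ℂ)⁻¹ * (Real.pi / (1 / 2)) = 1 := by
    push_cast
    field_simp
  rw [h1, one_mul]
  congr 1
  push_cast
  field_simp

/-- The Gaussian is fixed and each creation contributes `-i`. As the eigenvalues are nonzero,
`modeSpan` is preserved in both directions, as equality of domains requires. -/
theorem schwartzFourier_mode (m n : ℕ) :
    schwartzFourier (mode m n) = (-Complex.I) ^ (m + n) • mode m n := by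
  have h0 : schwartzFourier (mode 0 0) = (1 : ℂ) • mode 0 0 := by
    have hne : ((√Real.pi : ℝ) : ℂ) ≠ 0 := by
      rw [Complex.ofReal_ne_zero]; positivity
    have h := schwartzFourier_gaussian
    rw [gaussian_eq_smul_mode, map_smul] at h
    rw [one_smul]
    exact smul_right_injective _ hne h
  have h1 := (isLadder_mode_one 0).map_eq_smul schwartzFourier (schwartzFourier_cr 1) h0 n
  have h2 := (isLadder_mode_zero n).map_eq_smul schwartzFourier (schwartzFourier_cr 0) h1 m
  rw [h2, pow_add, mul_one]

theorem unitaryFourier_isConjugateBy : IsConjugateBy unitaryFourier T4 T5 := by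
  refine isConjugateBy_onModes unitaryFourier schwartzFourier unitaryFourier_toLTwo ?_ ?_
    (map_cubicReal_eq_cubicImag schwartzFourier (schwartzFourier_cr 0) (schwartzFourier_an 0)
      (schwartzFourier_cr 1) (schwartzFourier_an 1))
  · intro v hv
    refine modeSpan_le_comap (A := schwartzFourier.toLinearMap) (fun m n => ?_) hv
    rw [LinearEquiv.coe_coe, schwartzFourier_mode]
    exact modeSpan.smul_mem _ (mode_mem_modeSpan m n)
  · intro v hv
    refine modeSpan_le_comap (A := schwartzFourier.symm.toLinearMap) (fun m n => ?_) hv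
    have hne : (-Complex.I) ^ (m + n) ≠ 0 := pow_ne_zero _ (neg_ne_zero.mpr Complex.I_ne_zero)
    have h : schwartzFourier.symm (mode m n) = ((-Complex.I) ^ (m + n))⁻¹ • mode m n := by
      rw [LinearEquiv.symm_apply_eq, map_smul, schwartzFourier_mode, inv_smul_smul₀ hne]
    rw [LinearEquiv.coe_coe, h]
    exact modeSpan.smul_mem _ (mode_mem_modeSpan m n)

end Fourier

/-! ### The interchange of the variables -/

section Interchange

/-- The interchange of the coordinates of the plane. -/
def planeSwap : Plane ≃ₗᵢ[ℝ] Plane :=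
  LinearIsometryEquiv.piLpCongrLeft 2 ℝ ℝ (Equiv.swap 0 1)

theorem planeSwap_apply (p : Plane) (i : Fin 2) : planeSwap p i = p (Equiv.swap 0 1 i) := by
  rw [planeSwap, LinearIsometryEquiv.piLpCongrLeft_apply]
  simp [Equiv.piCongrLeft']

theorem planeSwap_eq (p : Plane) : planeSwap p = !₂[p 1, p 0] := by
  ext i
  rw [planeSwap_apply]
  fin_cases i <;> simp

theorem planeSwap_planeSwap (p : Plane) : planeSwap (planeSwap p) = p := by
  ext i
  rw [planeSwap_apply, planeSwap_apply, Equiv.swap_apply_self]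

theorem planeSwap_single (i : Fin 2) :
    planeSwap (EuclideanSpace.single i (1 : ℝ)) = EuclideanSpace.single (Equiv.swap 0 1 i) 1 := by
  ext j
  rw [planeSwap_apply]
  fin_cases i <;> fin_cases j <;> simp

/-- The interchange of the variables on the Schwartz space. -/
def schwartzSwap : 𝓢(Plane, ℂ) ≃ₗ[ℂ] 𝓢(Plane, ℂ) :=
  LinearEquiv.ofInvolutive
    (SchwartzMap.compCLMOfContinuousLinearEquiv ℂ planeSwap.toContinuousLinearEquiv).toLinearMap
    fun f => by
      ext p
      exact congrArg f (planeSwap_planeSwap p)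

theorem schwartzSwap_apply (f : 𝓢(Plane, ℂ)) (p : Plane) :
    schwartzSwap f p = f (planeSwap p) := rfl

/-- The interchange of the variables on `L²(ℝ²)`. -/
def unitarySwap : LTwo ≃ₗᵢ[ℂ] LTwo where
  toLinearEquiv := LinearEquiv.ofInvolutive
    (Lp.compMeasurePreservingₗ ℂ planeSwap planeSwap.measurePreserving) fun f => by
      refine Lp.ext ?_
      have h1 := Lp.coeFn_compMeasurePreserving f planeSwap.measurePreserving
      refine (Lp.coeFn_compMeasurePreserving _ planeSwap.measurePreserving).trans ?_
      filter_upwards [planeSwap.measurePreserving.quasiMeasurePreserving.ae h1] with p hp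
      refine hp.trans ?_
      rw [Function.comp_apply, planeSwap_planeSwap]
  norm_map' f := Lp.norm_compMeasurePreserving f planeSwap.measurePreserving

theorem unitarySwap_toLTwo (f : 𝓢(Plane, ℂ)) :
    unitarySwap (toLTwo f) = toLTwo (schwartzSwap f) := rfl

theorem isInterchange_unitarySwap : IsInterchange unitarySwap := by
  intro f
  filter_upwards [Lp.coeFn_compMeasurePreserving f planeSwap.measurePreserving] with p hp
  rw [← planeSwap_eq]
  exact hp

theorem schwartzSwap_position (i : Fin 2) (f : 𝓢(Plane, ℂ)) :
    schwartzSwap (position i f) = position (Equiv.swap 0 1 i) (schwartzSwap f) := by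
  ext p
  rw [schwartzSwap_apply, position_apply, position_apply, schwartzSwap_apply, planeSwap_apply]

theorem schwartzSwap_partialDeriv (i : Fin 2) (f : 𝓢(Plane, ℂ)) :
    schwartzSwap (partialDeriv i f) = partialDeriv (Equiv.swap 0 1 i) (schwartzSwap f) := by
  have h := SchwartzMap.lineDerivOp_compCLMOfContinuousLinearEquiv (𝕜 := ℂ)
    (EuclideanSpace.single (Equiv.swap 0 1 i) (1 : ℝ)) planeSwap.toContinuousLinearEquiv f
  rw [LinearIsometryEquiv.coe_toContinuousLinearEquiv, planeSwap_single, Equiv.swap_apply_self] at h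
  exact h.symm

theorem schwartzSwap_cr (i : Fin 2) (f : 𝓢(Plane, ℂ)) :
    schwartzSwap (cr i f) = cr (Equiv.swap 0 1 i) (schwartzSwap f) := by
  simp [cr, schwartzSwap_position, schwartzSwap_partialDeriv]

theorem schwartzSwap_an (i : Fin 2) (f : 𝓢(Plane, ℂ)) :
    schwartzSwap (an i f) = an (Equiv.swap 0 1 i) (schwartzSwap f) := by
  simp [an, schwartzSwap_position, schwartzSwap_partialDeriv]

theorem schwartzSwap_mode (m n : ℕ) : schwartzSwap (mode m n) = mode n m := by
  ext p
  rw [schwartzSwap_apply, planeSwap_eq, mode_eq_hermiteFunction, mode_eq_hermiteFunction]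
  congr 1
  simp
  ring

theorem schwartzSwap_mem_modeSpan : ∀ v ∈ modeSpan, schwartzSwap v ∈ modeSpan := by
  intro v hv
  refine modeSpan_le_comap (A := schwartzSwap.toLinearMap) (fun m n => ?_) hv
  rw [LinearEquiv.coe_coe, schwartzSwap_mode]
  exact mode_mem_modeSpan n m

theorem unitarySwap_isConjugateBy_T4_T6 : IsConjugateBy unitarySwap T4 T6 :=
  isConjugateBy_onModes unitarySwap schwartzSwap unitarySwap_toLTwo schwartzSwap_mem_modeSpan
    schwartzSwap_mem_modeSpan
    (map_cubicReal schwartzSwap (schwartzSwap_cr 0) (schwartzSwap_an 0) (schwartzSwap_cr 1)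
      (schwartzSwap_an 1))

theorem unitarySwap_isConjugateBy_T5_T7 : IsConjugateBy unitarySwap T5 T7 :=
  isConjugateBy_onModes unitarySwap schwartzSwap unitarySwap_toLTwo schwartzSwap_mem_modeSpan
    schwartzSwap_mem_modeSpan
    (map_cubicImag schwartzSwap (schwartzSwap_cr 0) (schwartzSwap_an 0) (schwartzSwap_cr 1)
      (schwartzSwap_an 1))

end Interchange

theorem norm_ofReal_beta (n m : ℕ) : ‖(β n m : ℂ)‖ = |β n m| := by
  rw [Complex.norm_real, Real.norm_eq_abs]

theorem norm_neg_I_mul_ofReal_beta (n m : ℕ) : ‖-Complex.I * (β n m : ℂ)‖ = |β n m| := by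
  rw [norm_mul, norm_neg, Complex.norm_I, one_mul, norm_ofReal_beta]

end CubicGenerator

end



theorem mainTheorem1 :
    -- the Hermite-Gaussian modes are orthonormal
    Orthonormal ℂ (fun k : ℕ × ℕ => toLTwo (mode k.1 k.2)) ∧
    -- for fixed order n in the other variable, the generators act as Jacobi matrices
    (∀ n : ℕ,
      ActsAsJacobi T4 (fun m => toLTwo (mode m n)) (fun m => (β n m : ℂ)) ∧
      ActsAsJacobi T5 (fun m => toLTwo (mode m n)) (fun m => -Complex.I * (β n m : ℂ)) ∧
      ActsAsJacobi T6 (fun m => toLTwo (mode n m)) (fun m => (β n m : ℂ)) ∧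
      ActsAsJacobi T7 (fun m => toLTwo (mode n m)) (fun m => -Complex.I * (β n m : ℂ))) ∧
    -- these Jacobi matrices are symmetric with deficiency indices (1, 1)
    (∀ n : ℕ,
      IsSymmetricOperator (jacobiOperator fun m => (β n m : ℂ)) ∧
      HasDeficiencyIndices (jacobiOperator fun m => (β n m : ℂ)) 1 1 ∧
      IsSymmetricOperator (jacobiOperator fun m => -Complex.I * (β n m : ℂ)) ∧
      HasDeficiencyIndices (jacobiOperator fun m => -Complex.I * (β n m : ℂ)) 1 1) ∧
    -- each generator is symmetric, with infinite deficiency indices, not essentially self-adjoint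
    (∀ T : LTwo →ₗ.[ℂ] LTwo, T = T4 ∨ T = T5 ∨ T = T6 ∨ T = T7 →
      IsSymmetricOperator T ∧ HasDeficiencyIndices T ⊤ ⊤ ∧ ¬ IsEssentiallySelfAdjoint T) ∧
    -- the Fourier transform and the interchange of the variables relate the generators
    (∃ F : LTwo ≃ₗᵢ[ℂ] LTwo, IsFourierTransform F ∧ IsConjugateBy F T4 T5) ∧
    (∃ S : LTwo ≃ₗᵢ[ℂ] LTwo,
      IsInterchange S ∧ IsConjugateBy S T4 T6 ∧ IsConjugateBy S T5 T7) := by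
  refine ⟨orthonormal_mode, fun n => ⟨T4_hasJacobiSectors.actsAsJacobi n,
    T5_hasJacobiSectors.actsAsJacobi n, T6_hasJacobiSectors.actsAsJacobi n,
    T7_hasJacobiSectors.actsAsJacobi n⟩, fun n => ?_, ?_,
    ⟨unitaryFourier, isFourierTransform_unitaryFourier, unitaryFourier_isConjugateBy⟩,
    ⟨unitarySwap, isInterchange_unitarySwap, unitarySwap_isConjugateBy_T4_T6,
      unitarySwap_isConjugateBy_T5_T7⟩⟩
  · exact ⟨(jacobiOperator_hasJacobiSectors _).isSymmetricOperator,
      hasDeficiencyIndices_jacobiOperator (norm_ofReal_beta n),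
      (jacobiOperator_hasJacobiSectors _).isSymmetricOperator,
      hasDeficiencyIndices_jacobiOperator (norm_neg_I_mul_ofReal_beta n)⟩
  · rintro T (rfl | rfl | rfl | rfl)
    · exact T4_hasJacobiSectors.main_properties norm_ofReal_beta
    · exact T5_hasJacobiSectors.main_properties norm_neg_I_mul_ofReal_beta
    · exact T6_hasJacobiSectors.main_properties norm_ofReal_beta
    · exact T7_hasJacobiSectors.main_properties norm_neg_I_mul_ofReal_beta
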